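/- **Theorem (a polynomial Karhunen–Loève theorem for the Brownian bridge).** Let $\mu$ be the Borel measure on $[0,1]$ with density $\frac{1}{x(1-x)}$ with respect to Lebesgue measure. There is a family of real polynomials $\{e_k\}_{k\ge 1}$ with $\deg e_k = k+1$ and $$\int_0^1 e_i\,e_j\,d\mu=\delta_{ij}\qquad(i,j\ge 1),$$ which is an orthonormal basis of $L^2([0,1],\mu)$, such that for every Brownian bridge $B$ on $[0,1]$ (a centered Gaussian process, on some probability space $(\Omega,\mathcal F,\mathbb P)$, with covariance $\mathbb E[B_sB_t]=\min(s,t)-st$ and almost surely continuous paths) the following hold. 1. For every $k\ge 1$ the integral $$I_k:=\int_0^1 B_t\cdot\frac{e_k(t)}{t(1-t)}\,dt$$ converges absolutely almost surely, and $\{I_k\}_{k\ge1}$ are independent centered Gaussian random variables with $\operatorname{Var}(I_k)=\frac{1}{k(k+1)}$. 2. $B=\sum_{k=1}^\infty I_k e_k$, in the sense that for every $t\in[0,1]$ the series $\sum_{k=1}^\infty I_k e_k(t)$ converges to $B_t$ in $L^2(\mathbb P)$. 3. $\{e_k\}$ is an optimal orthonormal basis of $L^2([0,1],\mu)$ for approximating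 $B$ by truncated series expansions with respect to the norm $$\|X\|_{L^2_\mu(\mathbb P)}:=\sqrt{\mathbb E\Big[\int_0^1 (X_s)^2\,d\mu(s)\Big]}.$$ That is, for every $n\ge 0$ and every orthonormal basis $\{f_k\}_{k\ge1}$ of $L^2([0,1],\mu)$, with $J_k:=\int_0^1 B_t f_k(t)\,d\mu(t)$, $$\Big\|B-\sum_{k=1}^n I_k e_k\Big\|_{L^2_\mu(\mathbb P)}\le \Big\|B-\sum_{k=1}^n J_k f_k\Big\|_{L^2_\mu(\mathbb P)},$$ and the left-hand side is finite. -/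

import Mathlib

open MeasureTheory ProbabilityTheory Filter Topology
open scoped NNReal ENNReal unitInterval Polynomial

namespace BridgeKL

noncomputable section

/-- A standard Brownian bridge on `[0,1]`: a centered Gaussian process with covariance
`min s t - s t` and almost surely continuous paths. -/
structure IsBrownianBridge {Ω : Type*} [MeasurableSpace Ω] (B : I → Ω → ℝ) (P : Measure Ω) :
    Prop where
  gaussian : IsGaussianProcess B P
  centered : ∀ t : I, ∫ ω, B t ω ∂P = 0
  covariance_eq : ∀ s t : I, cov[B s, B t; P] = min (s : ℝ) (t : ℝ) - (s : ℝ) * (t : ℝ)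
  continuous_paths : ∀ᵐ ω ∂P, Continuous fun t : I => B t ω

/-- The Borel measure on `[0,1]` with density `1 / (x (1 - x))` with respect to Lebesgue measure
(the two endpoints form a Lebesgue null set, so the value of the density there is irrelevant). -/
def bridgeMeasure : Measure I :=
  (volume : Measure I).withDensity fun x => ENNReal.ofReal (1 / ((x : ℝ) * (1 - (x : ℝ))))

/-- The random coefficient `∫₀¹ X_t f(t) dμ(t)` of a process along a function `f` on `[0,1]`. -/
def coeff {Ω : Type*} (X : I → Ω → ℝ) (f : I → ℝ) (ω : Ω) : ℝ :=
  ∫ t, X t ω * f t ∂bridgeMeasure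

/-- The random coefficient `∫₀¹ X_t p(t) / (t (1 - t)) dt` of a process along a polynomial `p`. -/
def polyCoeff {Ω : Type*} (X : I → Ω → ℝ) (p : ℝ[X]) (ω : Ω) : ℝ :=
  ∫ t : I, X t ω * (p.eval (t : ℝ) / ((t : ℝ) * (1 - (t : ℝ))))

/-- The weighted norm `(𝔼 ∫₀¹ X_s² dμ(s)) ^ (1/2)` of a process, with values in `[0,∞]`. -/
def weightedNorm {Ω : Type*} [MeasurableSpace Ω] (P : Measure Ω) (X : I → Ω → ℝ) : ℝ≥0∞ :=
  (∫⁻ ω, ∫⁻ s, ENNReal.ofReal (X s ω ^ 2) ∂bridgeMeasure ∂P) ^ (1 / 2 : ℝ)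

end

end BridgeKL

/-! The kernel min(s,t) - st is the Green function of -d²/dx² on [0,1] with Dirichlet conditions, so
eigenfunctions of the covariance operator on L²(μ) solve e = -λ x(1-x) e''. Polynomial solutions
come from a Rodrigues formula (`rodrigues_ode`), with λ_k = 1/((k+1)(k+2)), counting from k = 0. The
same equation writes e_k as x(1-x) times the polynomial `quotPoly k`, so each coefficient is a
continuous path integrated against a polynomial, and the singular weight disappears. Orthogonality
follows from distinctness of the eigenvalues, completeness from Weierstrass approximation, as
`quotPoly k` has degree k.

A combination ∑ a_k I_k is a limit of finite Gaussian sums (`IsBrownianBridge.hasLaw_integral`); the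
Green function identity gives its variance ∑ a_k² λ_k, and the resulting characteristic functions
factor, which is independence. The mean square error at time t is t(1-t) - ∑ λ_k e_k(t)². It tends
to 0 by Parseval for the indicator of [0,t] in the Legendre basis 1, √λ_k e_k' of L²(dx)
(`hasSum_lam_mul_basisPoly_sq`).

For optimality, E ∫ B² dμ = 1, and Pythagoras along each path turns the squared error into 1 - ∑ E
J_k². Here E J_k² ≤ ∑_j ⟨f_k, e_j⟩² λ_j, with equality for the eigenbasis, and n orthonormal vectors
capture at most the n largest eigenvalues (`sum_tsum_inner_sq_mul_lam_le`). -/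

namespace BridgeKL

/-! ### Rodrigues polynomials and their differential equation. -/

open Polynomial in
/-- The unnormalised basis polynomial, given by a Rodrigues formula. -/
noncomputable def rodrigues (k : ℕ) : ℝ[X] := derivative^[k] ((X ^ 2 - X) ^ (k + 1))

-- Leibniz rule for a quadratic factor: only three terms survive. It is obtained by multiplying by X
-- twice.
open Polynomial in
lemma iterate_derivative_mul_quadratic (w : ℝ[X]) (k : ℕ) :
    derivative^[k + 1] ((X ^ 2 - X) * derivative w) =
      (X ^ 2 - X) * derivative^[k + 2] w + ((k : ℝ[X]) + 1) * (2 * X - 1) * derivative^[k + 1] w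
        + ((k : ℝ[X]) + 1) * (k : ℝ[X]) * derivative^[k] w := by
  have hD : ∀ j, derivative^[j] (derivative w) = derivative^[j + 1] w := fun j => by
    rw [← Function.iterate_succ_apply]
  have h : (X ^ 2 - X) * derivative w = derivative w * X * X - derivative w * X := by ring
  rw [h, iterate_derivative_sub, iterate_derivative_mul_X (derivative w * X),
    iterate_derivative_mul_X (derivative w)]
  simp only [Nat.add_sub_cancel]
  rw [iterate_derivative_mul_X (derivative w), hD, hD]
  rcases k with _ | k
  · simp; ring
  · simp only [Nat.add_sub_cancel]
    rw [hD]
    simp only [nsmul_eq_mul]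
    push_cast
    ring

-- The power w = (X² - X)^(k+1) satisfies (X² - X) w' = (k+1)(2X - 1) w. Differentiating this k+1
-- times, the terms containing 2X - 1 cancel.
open Polynomial in
lemma rodrigues_ode (k : ℕ) :
    (X ^ 2 - X) * derivative (derivative (rodrigues k)) =
      C (((k : ℝ) + 1) * (k + 2)) * rodrigues k := by
  set w : ℝ[X] := (X ^ 2 - X) ^ (k + 1) with hw
  have h1 : (X ^ 2 - X) * derivative w = ((k : ℝ[X]) + 1) * (2 * w * X - w) := by
    rw [hw, derivative_pow]
    simp only [derivative_sub, derivative_X_pow, derivative_X, Nat.add_sub_cancel]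
    simp [map_ofNat C 2]
    ring
  have h2 := congrArg (derivative^[k + 1]) h1
  rw [iterate_derivative_mul_quadratic] at h2
  have h3 : ((k : ℝ[X]) + 1) * (2 * w * X - w) = ((k + 1 : ℕ) : ℝ[X]) * (((2 : ℕ) : ℝ[X]) * (w * X) - w) := by
    push_cast; ring
  rw [h3, iterate_derivative_natCast_mul, iterate_derivative_sub, iterate_derivative_natCast_mul,
    iterate_derivative_mul_X] at h2
  simp only [Nat.add_sub_cancel, nsmul_eq_mul] at h2
  have h4 : derivative (derivative (rodrigues k)) = derivative^[k + 2] w := by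
    rw [Function.iterate_succ_apply', Function.iterate_succ_apply']; rfl
  have h5 : rodrigues k = derivative^[k] w := rfl
  rw [h4, h5]
  simp only [C_mul, C_add, C_1, map_natCast, map_ofNat]
  push_cast at h2
  linear_combination h2

open Polynomial in
lemma natDegree_rodrigues (k : ℕ) : (rodrigues k).natDegree = k + 2 := by
  have hq : ((X : ℝ[X]) ^ 2 - X).natDegree = 2 := by compute_degree!
  have h : (((X : ℝ[X]) ^ 2 - X) ^ (k + 1)).natDegree = 2 * (k + 1) := by
    rw [natDegree_pow, hq, mul_comm]
  have hlc : (((X : ℝ[X]) ^ 2 - X) ^ (k + 1)).coeff (2 * (k + 1)) ≠ 0 := by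
    rw [← h, coeff_natDegree, Ne, leadingCoeff_eq_zero]
    intro h0
    rw [h0] at h
    simp at h
  refine le_antisymm ((natDegree_iterate_derivative _ _).trans (by omega)) ?_
  apply le_natDegree_of_ne_zero
  rw [rodrigues, coeff_iterate_derivative, nsmul_eq_mul, show k + 2 + k = 2 * (k + 1) by ring]
  refine mul_ne_zero ?_ hlc
  exact_mod_cast (Nat.descFactorial_pos.2 (by omega)).ne'

/-! ### Eigenvalues and integration against μ. -/

/-- The `k`-th eigenvalue of the covariance operator of the bridge. -/
noncomputable def lam (k : ℕ) : ℝ := 1 / (((k : ℝ) + 1) * ((k : ℝ) + 2))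

lemma lam_pos (k : ℕ) : 0 < lam k := by unfold lam; positivity

lemma lam_antitone : Antitone lam := fun i j h => by
  have : (i : ℝ) ≤ j := by exact_mod_cast h
  unfold lam
  gcongr

lemma lam_injective : Function.Injective lam := by
  apply StrictAnti.injective
  intro i j h
  have : (i : ℝ) < j := by exact_mod_cast h
  unfold lam
  gcongr

lemma integral_unitInterval_eq (f : ℝ → ℝ) : ∫ t : I, f t = ∫ x in (0 : ℝ)..1, f x := by
  rw [unitInterval.measurePreserving_coe.integral_comp unitInterval.measurableEmbedding_coe,
    intervalIntegral.integral_of_le zero_le_one, ← integral_Icc_eq_integral_Ioc]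

lemma integral_bridgeMeasure (f : I → ℝ) :
    ∫ t, f t ∂bridgeMeasure = ∫ t : I, f t / ((t : ℝ) * (1 - t)) := by
  rw [bridgeMeasure, integral_withDensity_eq_integral_toReal_smul (by fun_prop) (by simp)]
  refine integral_congr_ae (.of_forall fun t => ?_)
  have h0 := t.2.1
  have h1 := t.2.2
  have : 0 ≤ 1 / ((t : ℝ) * (1 - t)) := by
    apply one_div_nonneg.2 (mul_nonneg h0 (by linarith))
  simp only [smul_eq_mul]
  rw [ENNReal.toReal_ofReal this]
  ring

lemma ae_interior : ∀ᵐ t : I, 0 < (t : ℝ) ∧ (t : ℝ) < 1 := by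
  have h0 : ∀ᵐ t : I, t ≠ 0 := by simp [ae_iff]
  have h1 : ∀ᵐ t : I, t ≠ 1 := by simp [ae_iff]
  filter_upwards [h0, h1] with t h0 h1
  exact ⟨unitInterval.pos_iff_ne_zero.2 h0, unitInterval.lt_one_iff_ne_one.2 h1⟩

lemma lintegral_bridgeMeasure {f : I → ℝ≥0∞} (hf : AEMeasurable f) :
    ∫⁻ t, f t ∂bridgeMeasure = ∫⁻ t : I, ENNReal.ofReal (1 / ((t : ℝ) * (1 - t))) * f t := by
  rw [bridgeMeasure, lintegral_withDensity_eq_lintegral_mul₀ (by fun_prop) hf]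
  rfl

lemma bridgeMeasure_absolutelyContinuous : bridgeMeasure ≪ (volume : Measure I) :=
  withDensity_absolutelyContinuous _ _

/-- The density is at least 1. This puts elements of L²(μ) in L²(dx), where polynomial density
applies. -/
lemma volume_le_bridgeMeasure : (volume : Measure I) ≤ bridgeMeasure := by
  rw [bridgeMeasure]
  conv_lhs => rw [← withDensity_one (μ := (volume : Measure I))]
  apply withDensity_mono
  filter_upwards [ae_interior] with t ht
  rw [Pi.one_apply, ENNReal.one_le_ofReal, one_le_div (by nlinarith [ht.1, ht.2])]
  nlinarith [ht.1, ht.2]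

instance : SigmaFinite bridgeMeasure := by
  unfold bridgeMeasure; infer_instance

lemma integral_sq_eval_pos {p : ℝ[X]} (hp : p ≠ 0) : 0 < ∫ x in (0 : ℝ)..1, p.eval x ^ 2 := by
  apply intervalIntegral.integral_pos zero_lt_one (by fun_prop) (fun _ _ => sq_nonneg _)
  by_contra! h
  apply hp
  apply Polynomial.eq_zero_of_infinite_isRoot
  apply (Set.Icc_infinite (zero_lt_one (α := ℝ))).mono
  intro c hc
  have := h c hc
  exact pow_eq_zero_iff (two_ne_zero) |>.1 (le_antisymm this (sq_nonneg _))

/-! ### Normalisation and orthonormality in L²(μ). -/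

lemma integral_eval_mul_deriv_deriv {p : ℝ[X]} (h0 : p.eval 0 = 0) (h1 : p.eval 1 = 0) (q : ℝ[X]) :
    ∫ x in (0 : ℝ)..1, p.eval x * q.derivative.derivative.eval x =
      -∫ x in (0 : ℝ)..1, p.derivative.eval x * q.derivative.eval x := by
  rw [intervalIntegral.integral_mul_deriv_eq_deriv_mul (fun x _ => p.hasDerivAt x)
    (fun x _ => q.derivative.hasDerivAt x)
    (Continuous.intervalIntegrable (by fun_prop) _ _)
    (Continuous.intervalIntegrable (by fun_prop) _ _), h0, h1]
  simp

/-- The differential equation forces the boundary values: X² - X vanishes at the endpoints while the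
eigenvalue factor does not. -/
lemma rodrigues_eval_zero (k : ℕ) : (rodrigues k).eval 0 = 0 := by
  have h := congrArg (Polynomial.eval 0) (rodrigues_ode k)
  have : ((k : ℝ) + 1) * (k + 2) ≠ 0 := by positivity
  simpa [this, (by positivity : (k : ℝ) + 1 ≠ 0), (by positivity : (k : ℝ) + 2 ≠ 0)] using h

lemma rodrigues_eval_one (k : ℕ) : (rodrigues k).eval 1 = 0 := by
  have h := congrArg (Polynomial.eval 1) (rodrigues_ode k)
  simpa [(by positivity : (k : ℝ) + 1 ≠ 0), (by positivity : (k : ℝ) + 2 ≠ 0)] using h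

/-- The Dirichlet energy of the `k`-th Rodrigues polynomial. -/
noncomputable def energy (k : ℕ) : ℝ := ∫ x in (0 : ℝ)..1, (rodrigues k).derivative.eval x ^ 2

lemma energy_pos (k : ℕ) : 0 < energy k := by
  apply integral_sq_eval_pos
  intro h
  have := Polynomial.natDegree_derivative (rodrigues k)
  rw [h, natDegree_rodrigues] at this
  simp at this

/-- The factor which normalises the Rodrigues polynomials in `L²(μ)`. -/
noncomputable def normalizer (k : ℕ) : ℝ := √(1 / (lam k * energy k))

lemma normalizer_pos (k : ℕ) : 0 < normalizer k :=
  Real.sqrt_pos.2 (one_div_pos.2 (mul_pos (lam_pos k) (energy_pos k)))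

lemma normalizer_sq (k : ℕ) : normalizer k ^ 2 = 1 / (lam k * energy k) :=
  Real.sq_sqrt (one_div_pos.2 (mul_pos (lam_pos k) (energy_pos k))).le

/-- The orthonormal basis polynomials. -/
noncomputable def basisPoly (k : ℕ) : ℝ[X] := Polynomial.C (normalizer k) * rodrigues k

lemma natDegree_basisPoly (k : ℕ) : (basisPoly k).natDegree = k + 2 := by
  rw [basisPoly, Polynomial.natDegree_C_mul (normalizer_pos k).ne', natDegree_rodrigues]

lemma basisPoly_eval_zero (k : ℕ) : (basisPoly k).eval 0 = 0 := by
  simp [basisPoly, rodrigues_eval_zero]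

lemma basisPoly_eval_one (k : ℕ) : (basisPoly k).eval 1 = 0 := by
  simp [basisPoly, rodrigues_eval_one]

/-- The polynomial quotient of `basisPoly k` by `X (1 - X)`. -/
noncomputable def quotPoly (k : ℕ) : ℝ[X] :=
  Polynomial.C (-lam k) * (basisPoly k).derivative.derivative

lemma natDegree_quotPoly (k : ℕ) : (quotPoly k).natDegree = k := by
  rw [quotPoly, Polynomial.natDegree_C_mul (neg_ne_zero.2 (lam_pos k).ne'),
    Polynomial.natDegree_derivative, Polynomial.natDegree_derivative, natDegree_basisPoly]
  rfl

lemma basisPoly_eval_eq (k : ℕ) (t : ℝ) :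
    (basisPoly k).eval t = t * (1 - t) * (quotPoly k).eval t := by
  have h := congrArg (Polynomial.eval t) (rodrigues_ode k)
  have h1 : lam k * (((k : ℝ) + 1) * (k + 2)) = 1 := by
    unfold lam; field_simp
  simp only [quotPoly, basisPoly, Polynomial.derivative_C_mul, Polynomial.eval_mul,
    Polynomial.eval_C, Polynomial.eval_sub, Polynomial.eval_pow, Polynomial.eval_X] at h ⊢
  linear_combination (-normalizer k * lam k) * h - (normalizer k * (rodrigues k).eval t) * h1

lemma basisPoly_div (k : ℕ) :
    ∀ᵐ t : I, (basisPoly k).eval (t : ℝ) / ((t : ℝ) * (1 - t)) = (quotPoly k).eval (t : ℝ) := by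
  filter_upwards [ae_interior] with t ht
  have : (t : ℝ) * (1 - t) ≠ 0 := mul_ne_zero ht.1.ne' (by linarith [ht.2])
  rw [basisPoly_eval_eq, mul_div_cancel_left₀ _ this]

lemma integral_mul_basisPoly_bridgeMeasure (f : I → ℝ) (k : ℕ) :
    ∫ t, f t * (basisPoly k).eval (t : ℝ) ∂bridgeMeasure =
      ∫ t : I, f t * (quotPoly k).eval (t : ℝ) := by
  rw [integral_bridgeMeasure]
  apply integral_congr_ae
  filter_upwards [basisPoly_div k] with t ht
  rw [← ht]; ring

/-- The weight cancels against the second factor, and integration by parts leaves the Dirichlet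
form. The factor `lam j` breaks the symmetry in i and j, which is what yields orthogonality. -/
lemma integral_basisPoly_eq_energy (i j : ℕ) :
    ∫ t : I, (basisPoly i).eval (t : ℝ) * (basisPoly j).eval (t : ℝ) ∂bridgeMeasure =
      lam j * ∫ x in (0 : ℝ)..1, (basisPoly i).derivative.eval x * (basisPoly j).derivative.eval x := by
  rw [integral_mul_basisPoly_bridgeMeasure,
    integral_unitInterval_eq fun x => (basisPoly i).eval x * (quotPoly j).eval x]
  simp only [quotPoly, Polynomial.eval_mul, Polynomial.eval_C]
  rw [← neg_neg (∫ x in (0 : ℝ)..1, (basisPoly i).derivative.eval x * _),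
    ← integral_eval_mul_deriv_deriv (basisPoly_eval_zero i) (basisPoly_eval_one i), mul_neg,
    ← neg_mul, ← intervalIntegral.integral_const_mul]
  congr 1; ext x; ring

/-- Off the diagonal, symmetry of both the L²(μ) product and the Dirichlet form gives equality after
multiplying the latter by `lam i` or `lam j`; the eigenvalues are distinct, so it vanishes. -/
lemma integral_deriv_basisPoly (i j : ℕ) :
    lam j * ∫ x in (0 : ℝ)..1,
      (basisPoly i).derivative.eval x * (basisPoly j).derivative.eval x =
      if i = j then 1 else 0 := by
  split_ifs with h
  · subst h
    simp only [basisPoly, Polynomial.derivative_C_mul, Polynomial.eval_mul, Polynomial.eval_C]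
    have : ∀ x : ℝ, normalizer i * (rodrigues i).derivative.eval x *
        (normalizer i * (rodrigues i).derivative.eval x) =
        normalizer i ^ 2 * (rodrigues i).derivative.eval x ^ 2 := fun x => by ring
    simp_rw [this]
    rw [intervalIntegral.integral_const_mul, normalizer_sq, ← energy]
    have := (lam_pos i).ne'
    have := (energy_pos i).ne'
    field_simp
  · have h1 := integral_basisPoly_eq_energy i j
    have h2 := integral_basisPoly_eq_energy j i
    simp_rw [mul_comm ((basisPoly j).eval _), mul_comm ((basisPoly j).derivative.eval _)] at h2
    rw [h1] at h2
    have h3 : lam j ≠ lam i := fun h' => h (lam_injective h').symm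
    have h4 := mul_right_cancel₀ (a := lam j) (b := ∫ x in (0 : ℝ)..1,
      (basisPoly i).derivative.eval x * (basisPoly j).derivative.eval x) (c := lam i)
    by_contra h5
    exact h3 (h4 (right_ne_zero_of_mul h5) h2)

lemma integral_basisPoly (i j : ℕ) :
    ∫ t : I, (basisPoly i).eval (t : ℝ) * (basisPoly j).eval (t : ℝ) ∂bridgeMeasure =
      if i = j then 1 else 0 := by
  rw [integral_basisPoly_eq_energy, integral_deriv_basisPoly]

/-! ### The covariance kernel as a Green function. -/

/-- The covariance kernel of the Brownian bridge. -/
def bridgeKernel (s t : ℝ) : ℝ := min s t - s * t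

lemma bridgeKernel_comm (s t : ℝ) : bridgeKernel s t = bridgeKernel t s := by
  simp [bridgeKernel, min_comm, mul_comm]

/-- `bridgeKernel` is the Green function of `-d²/dx²` on `[0,1]` with Dirichlet conditions. -/
lemma integral_bridgeKernel_mul_deriv_deriv {p : ℝ[X]} (h0 : p.eval 0 = 0) (h1 : p.eval 1 = 0)
    {t : ℝ} (ht0 : 0 ≤ t) (ht1 : t ≤ 1) :
    ∫ s in (0 : ℝ)..1, bridgeKernel s t * p.derivative.derivative.eval s = -p.eval t := by
  have hc : Continuous fun s => bridgeKernel s t * p.derivative.derivative.eval s := by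
    unfold bridgeKernel; fun_prop
  -- The kernel has its kink at s = t. It is s(1-t) to the left and t(1-s) to the right, and each
  -- affine piece times p'' has an explicit antiderivative.
  rw [← intervalIntegral.integral_add_adjacent_intervals (b := t) (hc.intervalIntegrable _ _)
    (hc.intervalIntegrable _ _)]
  have e1 : ∫ s in (0 : ℝ)..t, bridgeKernel s t * p.derivative.derivative.eval s =
      ∫ s in (0 : ℝ)..t, (1 - t) * (s * p.derivative.derivative.eval s) := by
    apply intervalIntegral.integral_congr
    intro s hs
    rw [Set.uIcc_of_le ht0] at hs
    simp only [bridgeKernel, min_eq_left hs.2]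
    ring
  have e2 : ∫ s in t..1, bridgeKernel s t * p.derivative.derivative.eval s =
      ∫ s in t..1, t * ((1 - s) * p.derivative.derivative.eval s) := by
    apply intervalIntegral.integral_congr
    intro s hs
    rw [Set.uIcc_of_le ht1] at hs
    simp only [bridgeKernel, min_eq_right hs.1]
    ring
  have i1 : ∫ s in (0 : ℝ)..t, s * p.derivative.derivative.eval s =
      (t * p.derivative.eval t - p.eval t) - (0 * p.derivative.eval 0 - p.eval 0) := by
    apply intervalIntegral.integral_eq_sub_of_hasDerivAt
      (f := fun s => s * p.derivative.eval s - p.eval s)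
    · intro s _
      exact (((hasDerivAt_id' s).mul (p.derivative.hasDerivAt s)).sub
        (p.hasDerivAt s)).congr_deriv (by ring)
    · exact Continuous.intervalIntegrable (by fun_prop) _ _
  have i2 : ∫ s in t..1, (1 - s) * p.derivative.derivative.eval s =
      ((1 - 1) * p.derivative.eval 1 + p.eval 1) - ((1 - t) * p.derivative.eval t + p.eval t) := by
    apply intervalIntegral.integral_eq_sub_of_hasDerivAt
      (f := fun s => (1 - s) * p.derivative.eval s + p.eval s)
    · intro s _
      exact ((((hasDerivAt_id' s).const_sub 1).mul (p.derivative.hasDerivAt s)).add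
        (p.hasDerivAt s)).congr_deriv (by ring)
    · exact Continuous.intervalIntegrable (by fun_prop) _ _
  rw [e1, e2, intervalIntegral.integral_const_mul, intervalIntegral.integral_const_mul, i1, i2, h0,
    h1]
  ring

lemma integral_bridgeKernel_mul_quotPoly (k : ℕ) (t : I) :
    ∫ s : I, bridgeKernel t s * (quotPoly k).eval (s : ℝ) = lam k * (basisPoly k).eval (t : ℝ) := by
  rw [integral_unitInterval_eq fun s => bridgeKernel t s * (quotPoly k).eval s]
  have h := integral_bridgeKernel_mul_deriv_deriv (basisPoly_eval_zero k) (basisPoly_eval_one k)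
    t.2.1 t.2.2
  simp_rw [bridgeKernel_comm (t : ℝ)]
  rw [← neg_neg ((basisPoly k).eval (t : ℝ)), ← h, mul_neg, ← neg_mul,
    ← intervalIntegral.integral_const_mul]
  simp only [quotPoly, Polynomial.eval_mul, Polynomial.eval_C]
  congr 1; ext x; ring

/-! ### Completeness in L²(μ). -/

lemma inner_Lp_eq_integral {α : Type*} [MeasurableSpace α] {ν : Measure α} (f g : Lp ℝ 2 ν) :
    inner ℝ f g = ∫ t, f t * g t ∂ν := by
  rw [L2.inner_def]
  simp [mul_comm]

lemma inner_toLp_left {α : Type*} [MeasurableSpace α] {ν : Measure α} {f : α → ℝ}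
    (hf : MemLp f 2 ν) (g : Lp ℝ 2 ν) : inner ℝ (hf.toLp f) g = ∫ t, f t * g t ∂ν := by
  rw [inner_Lp_eq_integral]
  apply integral_congr_ae
  filter_upwards [hf.coeFn_toLp] with t ht
  rw [ht]

lemma inner_toLp_toLp {α : Type*} [MeasurableSpace α] {ν : Measure α} {f g : α → ℝ}
    (hf : MemLp f 2 ν) (hg : MemLp g 2 ν) :
    inner ℝ (hf.toLp f) (hg.toLp g) = ∫ t, f t * g t ∂ν := by
  rw [inner_toLp_left]
  apply integral_congr_ae
  filter_upwards [hg.coeFn_toLp] with t ht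
  rw [ht]

lemma memLp_of_continuous {f : I → ℝ} (hf : Continuous f) (p : ℝ≥0∞) : MemLp f p volume :=
  hf.memLp_of_hasCompactSupport (HasCompactSupport.of_compactSpace f)

lemma integrable_of_continuous {f : I → ℝ} (hf : Continuous f) : Integrable f :=
  memLp_one_iff_integrable.1 (memLp_of_continuous hf 1)

/-- Polynomials are uniformly dense in C([0,1]) by Weierstrass, and C([0,1]) is dense in L². -/
lemma ae_eq_zero_of_forall_integral_eval_eq_zero {g : I → ℝ} (hg : MemLp g 2 volume)
    (h : ∀ q : ℝ[X], ∫ t : I, g t * q.eval (t : ℝ) = 0) : g =ᵐ[volume] 0 := by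
  let L : C(I, ℝ) →L[ℝ] Lp ℝ 2 (volume : Measure I) := ContinuousMap.toLp 2 volume ℝ
  let φ : C(I, ℝ) → ℝ := fun f => inner ℝ (hg.toLp g) (L f)
  have hφ : Continuous φ := by fun_prop
  have hzero : ∀ f : C(I, ℝ), φ f = 0 := by
    intro f
    have hcl : closure (polynomialFunctions (I : Set ℝ) : Set C(I, ℝ)) = Set.univ := by
      have := polynomialFunctions.topologicalClosure (I : Set ℝ)
      rw [← Subalgebra.topologicalClosure_coe, this]; rfl
    have hf : f ∈ closure (polynomialFunctions (I : Set ℝ) : Set C(I, ℝ)) := by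
      rw [hcl]; trivial
    refine closure_minimal (t := {f | φ f = 0}) ?_ (isClosed_eq hφ continuous_const) hf
    rintro _ ⟨q, -, rfl⟩
    simp only [Set.mem_ofPred_eq, φ]
    rw [inner_toLp_left, ← h q]
    apply integral_congr_ae
    filter_upwards [ContinuousMap.coeFn_toLp (p := 2) (𝕜 := ℝ) (volume : Measure I)
      ((Polynomial.toContinuousMapOnAlgHom (I : Set ℝ)) q)] with t ht
    simp only [L]
    congr 1
  have hd : DenseRange L := ContinuousMap.toLp_denseRange ℝ (volume : Measure I) ℝ (by simp)
  have h0 : hg.toLp g = 0 := by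
    rw [← inner_self_eq_zero (𝕜 := ℝ)]
    have : (fun x => inner ℝ (hg.toLp g) x) = fun _ => (0 : ℝ) :=
      hd.equalizer (by fun_prop) continuous_const (funext hzero)
    exact congrFun this _
  rw [Lp.eq_zero_iff_ae_eq_zero] at h0
  exact hg.coeFn_toLp.symm.trans h0

lemma forall_integral_eval_eq_zero_of_sequence {g : I → ℝ} (hg : MemLp g 2 volume) {p : ℕ → ℝ[X]}
    (hp : ∀ n, (p n).degree = n) (h : ∀ n, ∫ t : I, g t * (p n).eval (t : ℝ) = 0) (q : ℝ[X]) :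
    ∫ t : I, g t * q.eval (t : ℝ) = 0 := by
  have hint : ∀ q : ℝ[X], Integrable fun t : I => g t * q.eval (t : ℝ) := fun q =>
    hg.integrable_mul (memLp_of_continuous (by fun_prop) 2)
  let S : Polynomial.Sequence ℝ := ⟨p, hp⟩
  have hS := S.span fun i => isUnit_iff_ne_zero.2 (Polynomial.leadingCoeff_ne_zero.2 (S.ne_zero i))
  have hq : q ∈ Submodule.span ℝ (Set.range S) := by rw [hS]; trivial
  induction hq using Submodule.span_induction with
  | mem x hx => obtain ⟨n, rfl⟩ := hx; exact h n
  | zero => simp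
  | add x y _ _ hx hy =>
    simp only [Polynomial.eval_add, mul_add]
    rw [integral_add (hint x) (hint y), hx, hy, add_zero]
  | smul a x _ hx =>
    simp only [Polynomial.eval_smul, smul_eq_mul, mul_left_comm _ a]
    rw [integral_const_mul, hx, mul_zero]

lemma integrable_bridgeMeasure_iff {f : I → ℝ} :
    Integrable f bridgeMeasure ↔ Integrable fun t : I => f t / ((t : ℝ) * (1 - t)) := by
  rw [bridgeMeasure, integrable_withDensity_iff_integrable_smul' (by fun_prop) (by simp)]
  apply integrable_congr
  filter_upwards [ae_interior] with t ht
  have : 0 ≤ 1 / ((t : ℝ) * (1 - t)) :=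
    one_div_nonneg.2 (mul_nonneg ht.1.le (by linarith [ht.2]))
  rw [ENNReal.toReal_ofReal this, smul_eq_mul]
  ring

lemma memLp_basisPoly (k : ℕ) : MemLp (fun t : I => (basisPoly k).eval (t : ℝ)) 2 bridgeMeasure := by
  rw [memLp_two_iff_integrable_sq (Continuous.aestronglyMeasurable (by fun_prop)),
    integrable_bridgeMeasure_iff]
  have h : Integrable fun t : I => (basisPoly k).eval (t : ℝ) * (quotPoly k).eval (t : ℝ) :=
    integrable_of_continuous (by fun_prop)
  refine h.congr ?_
  filter_upwards [basisPoly_div k] with t ht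
  rw [← ht]; ring

lemma basisPoly_ne_zero (k : ℕ) : basisPoly k ≠ 0 := fun h => by
  have := natDegree_basisPoly k
  simp [h] at this

lemma degree_quotPoly (k : ℕ) : (quotPoly k).degree = k := by
  rw [Polynomial.degree_eq_natDegree, natDegree_quotPoly]
  intro h
  apply basisPoly_ne_zero k
  apply Polynomial.funext
  intro t
  rw [basisPoly_eval_eq, h]
  simp

/-- The basis polynomials as vectors of `L²(μ)`. -/
noncomputable def basisVec (k : ℕ) : Lp ℝ 2 bridgeMeasure := (memLp_basisPoly k).toLp _

lemma orthonormal_basisVec : Orthonormal ℝ basisVec := by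
  rw [orthonormal_iff_ite]
  intro i j
  rw [basisVec, basisVec, inner_toLp_toLp, integral_basisPoly]

/-- Orthogonality to e_k under μ is Lebesgue orthogonality to `quotPoly k`. These have one degree
each, hence span all polynomials. -/
lemma span_basisVec_orthogonal : (Submodule.span ℝ (Set.range basisVec))ᗮ = ⊥ := by
  rw [Submodule.eq_bot_iff]
  intro g hg
  have hmem : MemLp g 2 (volume : Measure I) := (Lp.memLp g).mono_measure volume_le_bridgeMeasure
  have hz : ∀ k, ∫ t : I, g t * (quotPoly k).eval (t : ℝ) = 0 := by
    intro k
    have := Submodule.mem_orthogonal' _ g |>.1 hg (basisVec k) (Submodule.subset_span ⟨k, rfl⟩)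
    rw [real_inner_comm, basisVec, inner_toLp_left] at this
    rw [← integral_mul_basisPoly_bridgeMeasure, ← this]
    simp_rw [mul_comm]
  have h0 := ae_eq_zero_of_forall_integral_eval_eq_zero hmem
    (forall_integral_eval_eq_zero_of_sequence hmem degree_quotPoly hz)
  rw [Lp.eq_zero_iff_ae_eq_zero]
  exact bridgeMeasure_absolutelyContinuous.ae_le h0

/-- The basis polynomials as a Hilbert basis of `L²(μ)`. -/
noncomputable def bridgeBasis : HilbertBasis ℕ ℝ (Lp ℝ 2 bridgeMeasure) :=
  HilbertBasis.mkOfOrthogonalEqBot orthonormal_basisVec span_basisVec_orthogonal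

lemma bridgeBasis_apply (k : ℕ) : bridgeBasis k = basisVec k := by
  rw [bridgeBasis, HilbertBasis.coe_mkOfOrthogonalEqBot]

lemma bridgeBasis_ae_eq (k : ℕ) :
    bridgeBasis k =ᵐ[bridgeMeasure] fun t : I => (basisPoly k).eval (t : ℝ) := by
  rw [bridgeBasis_apply]
  exact (memLp_basisPoly k).coeFn_toLp

/-! ### The Legendre basis and the Mercer expansion. -/

/-- The normalised shifted Legendre polynomials, built from the derivatives of `basisPoly`. -/
noncomputable def legendrePoly : ℕ → ℝ[X]
  | 0 => 1
  | k + 1 => Polynomial.C √(lam k) * (basisPoly k).derivative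

lemma degree_legendrePoly : ∀ n, (legendrePoly n).degree = n
  | 0 => by simp [legendrePoly]
  | k + 1 => by
    have h : (basisPoly k).derivative.natDegree = k + 1 := by
      rw [Polynomial.natDegree_derivative, natDegree_basisPoly]; rfl
    rw [legendrePoly, Polynomial.degree_C_mul (Real.sqrt_pos.2 (lam_pos k)).ne',
      Polynomial.degree_eq_natDegree, h]
    rintro h0
    simp [h0] at h

lemma integral_deriv_basisPoly_le (k : ℕ) (t : ℝ) :
    ∫ x in (0 : ℝ)..t, (basisPoly k).derivative.eval x = (basisPoly k).eval t := by
  rw [intervalIntegral.integral_eq_sub_of_hasDerivAt (fun x _ => (basisPoly k).hasDerivAt x)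
    (Continuous.intervalIntegrable (by fun_prop) _ _), basisPoly_eval_zero, sub_zero]

lemma memLp_legendrePoly (n : ℕ) :
    MemLp (fun t : I => (legendrePoly n).eval (t : ℝ)) 2 volume :=
  memLp_of_continuous (by fun_prop) 2

/-- Pairings with the constant reduce to boundary values of `basisPoly`; the others are the
Dirichlet products already computed. -/
lemma integral_legendrePoly : ∀ i j, ∫ t : I, (legendrePoly i).eval (t : ℝ) *
    (legendrePoly j).eval (t : ℝ) = if i = j then 1 else 0
  | 0, 0 => by simp [legendrePoly]
  | 0, j + 1 => by
    rw [integral_unitInterval_eq fun x => (legendrePoly 0).eval x * (legendrePoly (j + 1)).eval x]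
    simp [legendrePoly, integral_deriv_basisPoly_le, basisPoly_eval_one]
  | j + 1, 0 => by
    rw [integral_unitInterval_eq fun x => (legendrePoly (j + 1)).eval x * (legendrePoly 0).eval x]
    simp [legendrePoly, integral_deriv_basisPoly_le, basisPoly_eval_one]
  | i + 1, j + 1 => by
    rw [integral_unitInterval_eq fun x =>
      (legendrePoly (i + 1)).eval x * (legendrePoly (j + 1)).eval x]
    have h := integral_deriv_basisPoly i j
    simp only [legendrePoly, Polynomial.eval_mul, Polynomial.eval_C, add_left_inj]
    have e : ∀ x : ℝ, √(lam i) * (basisPoly i).derivative.eval x *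
      (√(lam j) * (basisPoly j).derivative.eval x) = √(lam i) * √(lam j) *
        ((basisPoly i).derivative.eval x * (basisPoly j).derivative.eval x) := fun x => by ring
    simp_rw [e]
    rw [intervalIntegral.integral_const_mul]
    split_ifs at h ⊢ with hij
    · subst hij
      rw [Real.mul_self_sqrt (lam_pos i).le, h]
    · rw [(mul_eq_zero.1 h).resolve_left (lam_pos j).ne', mul_zero]

/-- The normalised shifted Legendre polynomials as vectors of `L²([0,1])`. -/
noncomputable def legendreVec (n : ℕ) : Lp ℝ 2 (volume : Measure I) :=
  (memLp_legendrePoly n).toLp _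

lemma orthonormal_legendreVec : Orthonormal ℝ legendreVec := by
  rw [orthonormal_iff_ite]
  intro i j
  rw [legendreVec, legendreVec, inner_toLp_toLp, integral_legendrePoly]

lemma span_legendreVec_orthogonal : (Submodule.span ℝ (Set.range legendreVec))ᗮ = ⊥ := by
  rw [Submodule.eq_bot_iff]
  intro g hg
  have hz : ∀ k, ∫ t : I, g t * (legendrePoly k).eval (t : ℝ) = 0 := by
    intro k
    have := Submodule.mem_orthogonal' _ g |>.1 hg (legendreVec k) (Submodule.subset_span ⟨k, rfl⟩)
    rw [real_inner_comm, legendreVec, inner_toLp_left] at this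
    rw [← this]
    simp_rw [mul_comm]
  rw [Lp.eq_zero_iff_ae_eq_zero]
  exact ae_eq_zero_of_forall_integral_eval_eq_zero (Lp.memLp g)
    (forall_integral_eval_eq_zero_of_sequence (Lp.memLp g) degree_legendrePoly hz)

/-- The normalised shifted Legendre polynomials as a Hilbert basis of `L²([0,1])`. -/
noncomputable def legendreBasis : HilbertBasis ℕ ℝ (Lp ℝ 2 (volume : Measure I)) :=
  HilbertBasis.mkOfOrthogonalEqBot orthonormal_legendreVec span_legendreVec_orthogonal

lemma integral_indicator_unitInterval (t : I) (f : ℝ → ℝ) :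
    ∫ s : I, {x : ℝ | x ≤ t}.indicator f s = ∫ x in (0 : ℝ)..t, f x := by
  rw [integral_unitInterval_eq, intervalIntegral.integral_indicator t.2]

/-- The Mercer expansion of the bridge kernel on the diagonal. -/
lemma hasSum_lam_mul_basisPoly_sq (t : I) :
    HasSum (fun k => lam k * (basisPoly k).eval (t : ℝ) ^ 2) ((t : ℝ) * (1 - t)) := by
  -- Parseval is applied to the indicator of [0,t]: its squared norm is t, and its coefficients are
  -- t and √λ_k e_k(t).
  let f : I → ℝ := fun s => {x : ℝ | x ≤ t}.indicator 1 (s : ℝ)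
  have hf : MemLp f 2 volume := by
    apply MemLp.of_bound (C := 1)
    · apply Measurable.aestronglyMeasurable
      exact (measurable_one.indicator measurableSet_Iic).comp measurable_subtype_coe
    · refine .of_forall fun s => ?_
      simp only [f, Set.indicator_apply]
      split_ifs <;> simp
  have hfp : ∀ p : ℝ[X], ∫ s : I, f s * p.eval (s : ℝ) = ∫ x in (0 : ℝ)..t, p.eval x := by
    intro p
    rw [← integral_indicator_unitInterval]
    congr 1; ext s
    simp only [f, Set.indicator_apply]
    split_ifs <;> simp
  have hff : ∫ s : I, f s * f s = t := by
    have := hfp 1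
    simp only [Polynomial.eval_one, intervalIntegral.integral_const, sub_zero, smul_eq_mul,
      mul_one] at this
    rw [← this]
    congr 1; ext s
    simp only [f, Set.indicator_apply]
    split_ifs <;> simp
  have hb : ∀ n, legendreBasis n = legendreVec n := fun n => by
    rw [legendreBasis, HilbertBasis.coe_mkOfOrthogonalEqBot]
  have hs := legendreBasis.hasSum_inner_mul_inner (hf.toLp f) (hf.toLp f)
  simp_rw [hb, real_inner_comm (hf.toLp f), inner_toLp_toLp, legendreVec, inner_toLp_toLp, hff,
    hfp] at hs
  -- Removing the constant mode subtracts t², which leaves t(1-t).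
  rw [← hasSum_nat_add_iff' 1] at hs
  have e1 : (fun k => lam k * (basisPoly k).eval (t : ℝ) ^ 2) = fun k =>
      (∫ x in (0 : ℝ)..t, (legendrePoly (k + 1)).eval x) *
        ∫ x in (0 : ℝ)..t, (legendrePoly (k + 1)).eval x := by
    ext k
    simp only [legendrePoly, Polynomial.eval_mul, Polynomial.eval_C]
    rw [intervalIntegral.integral_const_mul, integral_deriv_basisPoly_le, mul_mul_mul_comm,
      Real.mul_self_sqrt (lam_pos k).le, sq]
  have e2 : (t : ℝ) * (1 - t) = t - ∑ i ∈ Finset.range 1,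
      (∫ x in (0 : ℝ)..t, (legendrePoly i).eval x) * ∫ x in (0 : ℝ)..t, (legendrePoly i).eval x := by
    simp [legendrePoly]
    ring
  rw [e1, e2]
  exact hs

/-! ### A measurable version with continuous paths. -/

/-- A Brownian bridge agrees almost surely with one whose coordinates are measurable and all of
whose paths are continuous. -/
lemma IsBrownianBridge.exists_continuous_version {Ω : Type*} [MeasurableSpace Ω] {P : Measure Ω}
    {B : I → Ω → ℝ} (hB : IsBrownianBridge B P) :
    ∃ C : I → Ω → ℝ, IsBrownianBridge C P ∧ (∀ t, Measurable (C t)) ∧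
      (∀ ω, Continuous fun t => C t ω) ∧ ∀ᵐ ω ∂P, ∀ t, B t ω = C t ω := by
  let q : ℕ → I := TopologicalSpace.denseSeq I
  have hq : DenseRange q := TopologicalSpace.denseRange_denseSeq I
  have hm : ∀ n, AEMeasurable (B (q n)) P := fun n => hB.gaussian.aemeasurable _
  -- Only countably many times are controlled, so the exceptional set is null; at other times
  -- measurability of C passes to the limit along continuous paths.
  let N : Set Ω := toMeasurable P
    {ω | ¬((Continuous fun t => B t ω) ∧ ∀ n, B (q n) ω = (hm n).mk _ ω)}
  have hN : P N = 0 := by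
    rw [measure_toMeasurable]
    have : ∀ᵐ ω ∂P, (Continuous fun t => B t ω) ∧ ∀ n, B (q n) ω = (hm n).mk _ ω :=
      hB.continuous_paths.and (ae_all_iff.2 fun n => (hm n).ae_eq_mk)
    exact this
  have hgood : ∀ ω ∉ N, (Continuous fun t => B t ω) ∧ ∀ n, B (q n) ω = (hm n).mk _ ω := by
    intro ω hω
    by_contra h
    exact hω (subset_toMeasurable _ _ h)
  let C : I → Ω → ℝ := fun t => Nᶜ.indicator (B t)
  have hcont : ∀ ω, Continuous fun t => C t ω := by
    intro ω
    by_cases hω : ω ∈ N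
    · simpa [C, hω] using continuous_const
    · simpa [C, hω] using (hgood ω hω).1
  have hBC : ∀ᵐ ω ∂P, ∀ t, B t ω = C t ω := by
    filter_upwards [measure_eq_zero_iff_ae_notMem.1 hN] with ω hω t
    simp [C, hω]
  have hmeas : ∀ t, Measurable (C t) := by
    have h1 : ∀ n, Measurable (C (q n)) := by
      intro n
      have : C (q n) = Nᶜ.indicator ((hm n).mk _) := by
        ext ω
        by_cases hω : ω ∈ N
        · simp [C, hω]
        · simp [C, hω, (hgood ω hω).2 n]
      rw [this]
      exact (hm n).measurable_mk.indicator (measurableSet_toMeasurable _ _).compl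
    intro t
    obtain ⟨x, hx, hxt⟩ := mem_closure_iff_seq_limit.1 (hq t)
    refine measurable_of_tendsto_metrizable (f := fun i => C (x i)) (fun i => ?_) ?_
    · obtain ⟨n, hn⟩ := hx i
      simpa only [← hn] using h1 n
    · exact tendsto_pi_nhds.2 fun ω => ((hcont ω).tendsto t).comp hxt
  have hae : ∀ t, B t =ᵐ[P] C t := fun t => hBC.mono fun ω h => h t
  refine ⟨C, ⟨hB.gaussian.congr hae, fun t => ?_, fun s t => ?_, .of_forall hcont⟩, hmeas, hcont,
    hBC⟩
  · rw [← hB.centered t, integral_congr_ae (hae t)]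
  · rw [← hB.covariance_eq s t, covariance, covariance, integral_congr_ae (hae s),
      integral_congr_ae (hae t)]
    apply integral_congr_ae
    filter_upwards [hae s, hae t] with ω h1 h2
    rw [h1, h2]

/-! ### Gaussian laws of path integrals. -/

section Gaussian

variable {Ω : Type*} [MeasurableSpace Ω] {P : Measure Ω}

lemma integral_comp_simpleFunc {α β : Type*} [MeasurableSpace α] (ν : Measure α)
    [IsFiniteMeasure ν] (τ : SimpleFunc α β) (F : β → ℝ) :
    ∫ t, F (τ t) ∂ν = ∑ x ∈ τ.range, ν.real (τ ⁻¹' {x}) * F x := by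
  have h : ∀ t, F (τ t) = ∑ x ∈ τ.range, (τ ⁻¹' {x}).indicator (fun _ => F x) t := by
    intro t
    rw [Finset.sum_eq_single (τ t)]
    · simp
    · intro x _ hx
      simp [Ne.symm hx]
    · intro h
      exact absurd (τ.mem_range_self t) h
  simp_rw [h]
  rw [integral_finsetSum]
  · refine Finset.sum_congr rfl fun x _ => ?_
    rw [integral_indicator_const _ (τ.measurableSet_fiber x), smul_eq_mul]
  · intro x _
    exact (integrable_const _).indicator (τ.measurableSet_fiber x)

lemma tendsto_integral_of_bounded {α : Type*} [MeasurableSpace α] {ν : Measure α}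
    [IsFiniteMeasure ν] {F : ℕ → α → ℝ} {f : α → ℝ} (M : ℝ)
    (hF : ∀ n, AEStronglyMeasurable (F n) ν) (hM : ∀ n t, |F n t| ≤ M)
    (h : ∀ t, Tendsto (fun n => F n t) atTop (𝓝 (f t))) :
    Tendsto (fun n => ∫ t, F n t ∂ν) atTop (𝓝 (∫ t, f t ∂ν)) :=
  tendsto_integral_of_dominated_convergence (fun _ => M) hF (integrable_const M)
    (fun n => .of_forall (hM n)) (.of_forall h)

/-- An almost sure limit of centered Gaussian variables whose variances converge is a centered
Gaussian variable. -/
lemma hasLaw_gaussianReal_of_tendsto [IsProbabilityMeasure P] {X : ℕ → Ω → ℝ} {Y : Ω → ℝ}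
    {v : ℕ → ℝ≥0} {w : ℝ≥0} (hX : ∀ n, HasLaw (X n) (gaussianReal 0 (v n)) P)
    (hY : AEMeasurable Y P) (hXY : ∀ᵐ ω ∂P, Tendsto (fun n => X n ω) atTop (𝓝 (Y ω)))
    (hv : Tendsto v atTop (𝓝 w)) : HasLaw Y (gaussianReal 0 w) P := by
  refine ⟨hY, ?_⟩
  have := Measure.isProbabilityMeasure_map (μ := P) hY
  apply Measure.ext_of_charFun
  ext u
  have hchar : ∀ {Z : Ω → ℝ}, AEMeasurable Z P → charFun (P.map Z) u =
      ∫ ω, Complex.exp (u * Z ω * Complex.I) ∂P := fun hZ => by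
    rw [charFun_apply_real, integral_map hZ (by fun_prop)]
  have h1 : Tendsto (fun n => charFun (P.map (X n)) u) atTop (𝓝 (charFun (P.map Y) u)) := by
    rw [hchar hY]
    simp_rw [hchar (hX _).aemeasurable]
    apply tendsto_integral_of_dominated_convergence (fun _ => (1 : ℝ))
    · intro n
      have := (hX n).aemeasurable
      exact AEMeasurable.aestronglyMeasurable (by fun_prop)
    · exact integrable_const _
    · intro n
      refine .of_forall fun ω => ?_
      rw [← Complex.ofReal_mul, Complex.norm_exp_ofReal_mul_I]
    · filter_upwards [hXY] with ω hω
      have hc : Continuous fun x : ℝ => Complex.exp (u * x * Complex.I) := by fun_prop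
      exact (hc.tendsto _).comp hω
  have h2 : Tendsto (fun n => charFun (P.map (X n)) u) atTop
      (𝓝 (charFun (gaussianReal 0 w) u)) := by
    simp_rw [(hX _).map_eq, charFun_gaussianReal]
    have hc : Continuous fun x : ℝ≥0 =>
        Complex.exp (u * (0 : ℝ) * Complex.I - ((x : ℝ) : ℂ) * u ^ 2 / 2) := by fun_prop
    exact (hc.tendsto _).comp hv
  exact tendsto_nhds_unique h1 h2

variable {C : I → Ω → ℝ}

lemma IsBrownianBridge.hasLaw_sum (hC : IsBrownianBridge C P) (s : Finset I) (c : I → ℝ) :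
    HasLaw (fun ω => ∑ x ∈ s, c x * C x ω) (gaussianReal 0
      (∑ x ∈ s, ∑ y ∈ s, c x * (c y * bridgeKernel x y)).toNNReal) P := by
  have hP := hC.gaussian.isProbabilityMeasure
  have hg : HasGaussianLaw (fun ω => ∑ x ∈ s, c x * C x ω) P :=
    (hC.gaussian.smul c).hasGaussianLaw_fun_sum
  have hx : ∀ x, MemLp (fun ω => c x * C x ω) 2 P := fun x =>
    (hC.gaussian.hasGaussianLaw_eval x).memLp_two.const_mul (c x)
  refine ⟨hg.aemeasurable, ?_⟩
  rw [hg.map_eq_gaussianReal, variance_fun_sum' fun x _ => hx x,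
    integral_finsetSum _ fun x _ => (hx x).integrable (by norm_num)]
  congr 1
  · refine Finset.sum_eq_zero fun x _ => ?_
    rw [integral_const_mul, hC.centered, mul_zero]
  · congr 1
    refine Finset.sum_congr rfl fun x _ => Finset.sum_congr rfl fun y _ => ?_
    rw [covariance_const_mul_left, covariance_const_mul_right, hC.covariance_eq, bridgeKernel]

/-- A continuous functional `∫ C_t r(t) dt` of a bridge is a centered Gaussian variable. -/
lemma IsBrownianBridge.hasLaw_integral (hC : IsBrownianBridge C P) (hm : ∀ t, Measurable (C t))
    (hc : ∀ ω, Continuous fun t => C t ω) {r : I → ℝ} (hr : Continuous r) :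
    HasLaw (fun ω => ∫ t : I, C t ω * r t) (gaussianReal 0
      (∫ s : I, ∫ t : I, bridgeKernel s t * r s * r t).toNNReal) P := by
  have hP := hC.gaussian.isProbabilityMeasure
  -- Simple functions converging to the identity play the role of Riemann partitions: composing with
  -- them turns the integral into a finite combination of values of C. Path continuity gives the
  -- limit of the sums, kernel continuity that of the variances.
  obtain ⟨τ, hτ⟩ : ∃ τ : ℕ → SimpleFunc I I, ∀ t, Tendsto (fun n => τ n t) atTop (𝓝 t) :=
    ⟨SimpleFunc.approxOn id measurable_id Set.univ 0 (Set.mem_univ 0), fun t =>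
      SimpleFunc.tendsto_approxOn measurable_id (Set.mem_univ 0) (by simp)⟩
  let c : ℕ → I → ℝ := fun n x => (volume : Measure I).real (τ n ⁻¹' {x}) * r x
  have hK : Continuous fun p : I × I => bridgeKernel p.1 p.2 * r p.1 * r p.2 := by
    unfold bridgeKernel; fun_prop
  obtain ⟨M, hM⟩ := isCompact_univ.exists_bound_of_continuousOn hK.continuousOn
  have hM' : ∀ s t : I, |bridgeKernel s t * r s * r t| ≤ M := fun s t => hM (s, t) trivial
  refine hasLaw_gaussianReal_of_tendsto (X := fun n ω => ∑ x ∈ (τ n).range, c n x * C x ω)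
    (fun n => hC.hasLaw_sum _ _) ?_ (.of_forall fun ω => ?_)
    ((continuous_real_toNNReal.tendsto _).comp ?_)
  · have hu := measurable_uncurry_of_continuous_of_measurable hc hm
    have : StronglyMeasurable (Function.uncurry fun (ω : Ω) (t : I) => C t ω * r t) :=
      ((hu.comp measurable_swap).mul (hr.measurable.comp measurable_snd)).stronglyMeasurable
    exact this.integral_prod_right.measurable.aemeasurable
  · have h1 : ∀ n, ∑ x ∈ (τ n).range, c n x * C x ω = ∫ t : I, C (τ n t) ω * r (τ n t) := by
      intro n
      rw [integral_comp_simpleFunc volume (τ n) fun x => C x ω * r x]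
      exact Finset.sum_congr rfl fun x _ => by simp only [c]; ring
    simp_rw [h1]
    have hcr : Continuous fun t => C t ω * r t := (hc ω).mul hr
    obtain ⟨M, hM⟩ := isCompact_univ.exists_bound_of_continuousOn hcr.continuousOn
    exact tendsto_integral_of_bounded M
      (fun n => (hcr.measurable.comp (τ n).measurable).aestronglyMeasurable)
      (fun n t => hM _ trivial) fun t => (hcr.tendsto t).comp (hτ t)
  · have h1 : ∀ n, ∑ x ∈ (τ n).range, ∑ y ∈ (τ n).range, c n x * (c n y * bridgeKernel x y) =
        ∫ s : I, ∫ t : I, bridgeKernel (τ n s) (τ n t) * r (τ n s) * r (τ n t) := by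
      intro n
      rw [integral_comp_simpleFunc volume (τ n) fun x =>
        ∫ t : I, bridgeKernel x (τ n t) * r x * r (τ n t)]
      refine Finset.sum_congr rfl fun x _ => ?_
      rw [integral_comp_simpleFunc volume (τ n) fun y => bridgeKernel x y * r x * r y,
        Finset.mul_sum]
      exact Finset.sum_congr rfl fun y _ => by simp only [c]; ring
    change Tendsto (fun n => ∑ x ∈ (τ n).range, ∑ y ∈ (τ n).range,
      c n x * (c n y * bridgeKernel x y)) atTop _
    simp_rw [h1]
    apply tendsto_integral_of_bounded M
    · intro n
      have : StronglyMeasurable (Function.uncurry fun (s t : I) =>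
          bridgeKernel (τ n s) (τ n t) * r (τ n s) * r (τ n t)) :=
        (hK.measurable.comp (((τ n).measurable.comp measurable_fst).prodMk
          ((τ n).measurable.comp measurable_snd))).stronglyMeasurable
      exact this.integral_prod_right.aestronglyMeasurable
    · intro n s
      have := norm_integral_le_of_norm_le_const (μ := (volume : Measure I)) (C := M)
        (f := fun t : I => bridgeKernel (τ n s) (τ n t) * r (τ n s) * r (τ n t))
        (.of_forall fun t => hM' (τ n s) (τ n t))
      simpa using this
    · intro s
      apply tendsto_integral_of_bounded M
      · intro n
        have : Measurable fun t : I => bridgeKernel (τ n s) (τ n t) * r (τ n s) * r (τ n t) :=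
          hK.measurable.comp (measurable_const.prodMk (τ n).measurable)
        exact this.aestronglyMeasurable
      · exact fun n t => hM' _ _
      · intro t
        exact (hK.tendsto (s, t)).comp ((hτ s).prodMk_nhds (hτ t))

end Gaussian

/-! ### Joint law and independence of the coefficients. -/

/-- A finite linear combination of the polynomials `quotPoly k`. -/
noncomputable def quotComb (s : Finset ℕ) (a : ℕ → ℝ) : ℝ[X] :=
  ∑ k ∈ s, Polynomial.C (a k) * quotPoly k

lemma eval_quotComb (s : Finset ℕ) (a : ℕ → ℝ) (t : ℝ) :
    (quotComb s a).eval t = ∑ k ∈ s, a k * (quotPoly k).eval t := by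
  simp [quotComb, Polynomial.eval_finsetSum]

lemma integral_mul_quotComb {f : I → ℝ} (hf : Continuous f) (s : Finset ℕ) (a : ℕ → ℝ) :
    ∫ t : I, f t * (quotComb s a).eval (t : ℝ) =
      ∑ k ∈ s, a k * ∫ t : I, f t * (quotPoly k).eval (t : ℝ) := by
  simp_rw [eval_quotComb, Finset.mul_sum, mul_left_comm (f _)]
  rw [integral_finsetSum]
  · simp_rw [integral_const_mul]
  · exact fun k _ => integrable_of_continuous (by fun_prop)

lemma integral_bridgeKernel_mul_quotComb (s : Finset ℕ) (a : ℕ → ℝ) (t : I) :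
    ∫ u : I, bridgeKernel t u * (quotComb s a).eval (u : ℝ) =
      ∑ k ∈ s, a k * (lam k * (basisPoly k).eval (t : ℝ)) := by
  rw [integral_mul_quotComb (by unfold bridgeKernel; fun_prop)]
  simp_rw [integral_bridgeKernel_mul_quotPoly]

lemma integral_basisPoly_mul_quotPoly (i j : ℕ) :
    ∫ t : I, (basisPoly i).eval (t : ℝ) * (quotPoly j).eval (t : ℝ) = if i = j then 1 else 0 := by
  rw [← integral_mul_basisPoly_bridgeMeasure fun t : I => (basisPoly i).eval (t : ℝ),
    integral_basisPoly]

/-- The kernel sends `quotPoly k` to `lam k` times `basisPoly k`, and these two families are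
biorthogonal for Lebesgue measure, so the quadratic form is diagonal. -/
lemma integral_integral_bridgeKernel_quotComb (s : Finset ℕ) (a : ℕ → ℝ) :
    ∫ u : I, ∫ v : I, bridgeKernel u v * (quotComb s a).eval (u : ℝ) * (quotComb s a).eval (v : ℝ) =
      ∑ k ∈ s, a k ^ 2 * lam k := by
  have h : ∀ u : I, ∫ v : I, bridgeKernel u v * (quotComb s a).eval (u : ℝ) *
      (quotComb s a).eval (v : ℝ) =
      (∑ k ∈ s, a k * (lam k * (basisPoly k).eval (u : ℝ))) * (quotComb s a).eval (u : ℝ) := by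
    intro u
    rw [← integral_bridgeKernel_mul_quotComb, ← integral_mul_const]
    congr 1; ext v; ring
  simp_rw [h]
  rw [integral_mul_quotComb (by fun_prop)]
  refine Finset.sum_congr rfl fun k hk => ?_
  simp_rw [Finset.sum_mul, mul_assoc]
  rw [integral_finsetSum _ fun j _ => integrable_of_continuous (by fun_prop)]
  simp_rw [integral_const_mul, integral_basisPoly_mul_quotPoly]
  simp [hk]
  ring

/-- The `k`-th coordinate of a process with continuous paths. -/
noncomputable def coord {Ω : Type*} (C : I → Ω → ℝ) (k : ℕ) (ω : Ω) : ℝ :=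
  ∫ t : I, C t ω * (quotPoly k).eval (t : ℝ)

lemma sum_mul_coord {Ω : Type*} {C : I → Ω → ℝ} (hc : ∀ ω, Continuous fun t => C t ω) (s : Finset ℕ) (a : ℕ → ℝ) (ω : Ω) :
    ∑ k ∈ s, a k * coord C k ω = ∫ t : I, C t ω * (quotComb s a).eval (t : ℝ) := by
  rw [integral_mul_quotComb (hc ω)]
  rfl

section Bridge

variable {Ω : Type*} [MeasurableSpace Ω] {P : Measure Ω} {C : I → Ω → ℝ}

lemma measurable_coord (hm : ∀ t, Measurable (C t)) (hc : ∀ ω, Continuous fun t => C t ω) (k : ℕ) :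
    Measurable (coord C k) := by
  have hu := measurable_uncurry_of_continuous_of_measurable hc hm
  have : StronglyMeasurable (Function.uncurry fun (ω : Ω) (t : I) =>
      C t ω * (quotPoly k).eval (t : ℝ)) :=
    ((hu.comp measurable_swap).mul ((quotPoly k).continuous.measurable.comp
      (measurable_subtype_coe.comp measurable_snd))).stronglyMeasurable
  exact this.integral_prod_right.measurable

lemma IsBrownianBridge.hasLaw_sum_coord (hC : IsBrownianBridge C P) (hm : ∀ t, Measurable (C t))
    (hc : ∀ ω, Continuous fun t => C t ω) (s : Finset ℕ) (a : ℕ → ℝ) :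
    HasLaw (fun ω => ∑ k ∈ s, a k * coord C k ω)
      (gaussianReal 0 (∑ k ∈ s, a k ^ 2 * lam k).toNNReal) P := by
  have := hC.hasLaw_integral hm hc (r := fun t : I => (quotComb s a).eval (t : ℝ)) (by fun_prop)
  rw [integral_integral_bridgeKernel_quotComb] at this
  simpa only [sum_mul_coord hc] using this

lemma IsBrownianBridge.hasLaw_coord (hC : IsBrownianBridge C P) (hm : ∀ t, Measurable (C t))
    (hc : ∀ ω, Continuous fun t => C t ω) (k : ℕ) :
    HasLaw (coord C k) (gaussianReal 0 (lam k).toNNReal) P := by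
  simpa using hC.hasLaw_sum_coord hm hc {k} 1

/-- The joint characteristic function at u is that of the scalar ∑ u_k I_k at 1. Its Gaussian
exponent is a sum over k, so it factors. -/
lemma IsBrownianBridge.iIndepFun_coord (hC : IsBrownianBridge C P) (hm : ∀ t, Measurable (C t))
    (hc : ∀ ω, Continuous fun t => C t ω) : iIndepFun (coord C) P := by
  have hP := hC.gaussian.isProbabilityMeasure
  have hmk := measurable_coord hm hc
  rw [iIndepFun_iff_finset]
  intro s
  have hs : ∀ i : s, AEMeasurable (s.restrict (coord C) i) P := fun i => (hmk i).aemeasurable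
  rw [iIndepFun_iff_charFun_pi hs]
  intro u
  let a : ℕ → ℝ := fun k => if h : k ∈ s then u.ofLp ⟨k, h⟩ else 0
  have ha : ∀ i : s, a i = u.ofLp i := fun i => by simp [a]
  have hinner : ∀ ω, inner ℝ (WithLp.toLp 2 fun i : s => s.restrict (coord C) i ω) u =
      ∑ k ∈ s, a k * coord C k ω := by
    intro ω
    rw [PiLp.inner_apply, ← Finset.sum_coe_sort s]
    refine Finset.sum_congr rfl fun i _ => ?_
    simp [ha]
  have h1 := (hC.hasLaw_sum_coord hm hc s a).map_eq
  have h2 : charFun (P.map fun ω => WithLp.toLp 2 fun i : s => s.restrict (coord C) i ω) u =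
      charFun (P.map fun ω => ∑ k ∈ s, a k * coord C k ω) 1 := by
    rw [charFun_apply, charFun_apply_real, integral_map, integral_map]
    · simp_rw [hinner]
      simp
    · exact (Finset.measurable_fun_sum s fun k _ => (hmk k).const_mul (a k)).aemeasurable
    · fun_prop
    · have : Measurable fun ω => (fun i : s => s.restrict (coord C) i ω) :=
        measurable_pi_lambda _ fun i => hmk i
      exact ((WithLp.measurable_toLp 2 _).comp this).aemeasurable
    · exact Continuous.aestronglyMeasurable (by fun_prop)
  rw [h2, h1, charFun_gaussianReal]
  have h3 : ∀ i : s, charFun (P.map (s.restrict (coord C) i)) (u.ofLp i) =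
      Complex.exp (-((a i ^ 2 * lam i : ℝ) / 2 : ℂ)) := by
    intro i
    rw [Finset.restrict, (hC.hasLaw_coord hm hc i).map_eq, charFun_gaussianReal, ha,
      Real.coe_toNNReal _ (lam_pos i).le]
    congr 1
    push_cast
    ring
  simp_rw [h3]
  rw [← Complex.exp_sum, Real.coe_toNNReal _
    (Finset.sum_nonneg fun k _ => mul_nonneg (sq_nonneg _) (lam_pos k).le),
    Finset.sum_coe_sort s fun i => -((a i ^ 2 * lam i : ℝ) / 2 : ℂ)]
  congr 1
  rw [Finset.sum_neg_distrib, ← Finset.sum_div]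
  push_cast
  ring

/-! ### Second moments and pointwise convergence. -/

lemma memLp_two_of_hasLaw_gaussian {X : Ω → ℝ} {v : ℝ≥0} (h : HasLaw X (gaussianReal 0 v) P) :
    MemLp X 2 P := by
  have hX : HasGaussianLaw X P := ⟨by rw [h.map_eq]; infer_instance⟩
  exact hX.memLp_two

lemma integral_sq_of_hasLaw_gaussian {X : Ω → ℝ} {v : ℝ≥0} (h : HasLaw X (gaussianReal 0 v) P) :
    ∫ ω, X ω ^ 2 ∂P = v := by
  have h0 : ∫ ω, X ω ∂P = 0 := by rw [h.integral_eq]; simp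
  rw [← variance_of_integral_eq_zero h.aemeasurable h0, h.variance_eq, variance_id_gaussianReal]

lemma lintegral_sq_of_hasLaw_gaussian {X : Ω → ℝ} {v : ℝ≥0} (h : HasLaw X (gaussianReal 0 v) P) :
    ∫⁻ ω, ENNReal.ofReal (X ω ^ 2) ∂P = v := by
  rw [← ofReal_integral_eq_lintegral_ofReal (memLp_two_of_hasLaw_gaussian h).integrable_sq
    (.of_forall fun _ => sq_nonneg _), integral_sq_of_hasLaw_gaussian h, ENNReal.ofReal_coe_nnreal]

lemma IsBrownianBridge.integral_mul (hC : IsBrownianBridge C P) (s t : I) :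
    ∫ ω, C s ω * C t ω ∂P = bridgeKernel s t := by
  have hP := hC.gaussian.isProbabilityMeasure
  have h := hC.covariance_eq s t
  rw [covariance_eq_sub (hC.gaussian.hasGaussianLaw_eval s).memLp_two
    (hC.gaussian.hasGaussianLaw_eval t).memLp_two, hC.centered, hC.centered] at h
  simpa [bridgeKernel] using h

lemma IsBrownianBridge.memLp_uncurry (hC : IsBrownianBridge C P) (hm : ∀ t, Measurable (C t))
    (hc : ∀ ω, Continuous fun t => C t ω) {r : I → ℝ} (hr : Continuous r) :
    MemLp (fun p : Ω × I => C p.2 p.1 * r p.2) 2 (P.prod volume) := by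
  have hP := hC.gaussian.isProbabilityMeasure
  have hu := measurable_uncurry_of_continuous_of_measurable hc hm
  have hmeas : Measurable fun p : Ω × I => C p.2 p.1 * r p.2 :=
    (hu.comp measurable_swap).mul (hr.measurable.comp measurable_snd)
  rw [memLp_two_iff_integrable_sq hmeas.aestronglyMeasurable,
    integrable_prod_iff' (hmeas.pow_const 2).aestronglyMeasurable]
  constructor
  · refine .of_forall fun t => ?_
    exact ((hC.gaussian.hasGaussianLaw_eval t).memLp_two.mul_const (r t)).integrable_sq
  · have : ∀ t : I, ∫ ω, ‖(C t ω * r t) ^ 2‖ ∂P = bridgeKernel t t * r t ^ 2 := by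
      intro t
      rw [← hC.integral_mul, ← integral_mul_const]
      congr 1; ext ω
      rw [Real.norm_of_nonneg (sq_nonneg _)]; ring
    simp_rw [this]
    exact integrable_of_continuous (by unfold bridgeKernel; fun_prop)

lemma IsBrownianBridge.integral_mul_integral (hC : IsBrownianBridge C P)
    (hm : ∀ t, Measurable (C t)) (hc : ∀ ω, Continuous fun t => C t ω) {r : I → ℝ}
    (hr : Continuous r) (t : I) :
    ∫ ω, C t ω * (∫ s : I, C s ω * r s) ∂P = ∫ s : I, bridgeKernel t s * r s := by
  have hP := hC.gaussian.isProbabilityMeasure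
  simp_rw [← integral_const_mul]
  rw [integral_integral_swap]
  · congr 1; ext s
    rw [← hC.integral_mul, ← integral_mul_const]
    congr 1; ext ω; ring
  · exact ((hC.gaussian.hasGaussianLaw_eval t).memLp_two.comp_fst volume).integrable_mul
      (hC.memLp_uncurry hm hc hr)

/-- The mean square error of the truncated expansion at a fixed time. -/
lemma IsBrownianBridge.integral_sub_sum_sq (hC : IsBrownianBridge C P)
    (hm : ∀ t, Measurable (C t)) (hc : ∀ ω, Continuous fun t => C t ω) (s : Finset ℕ) (t : I) :
    ∫ ω, (C t ω - ∑ k ∈ s, coord C k ω * (basisPoly k).eval (t : ℝ)) ^ 2 ∂P =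
      (t : ℝ) * (1 - t) - ∑ k ∈ s, lam k * (basisPoly k).eval (t : ℝ) ^ 2 := by
  let a : ℕ → ℝ := fun k => (basisPoly k).eval (t : ℝ)
  have hY := hC.hasLaw_sum_coord hm hc s a
  have hYm := memLp_two_of_hasLaw_gaussian hY
  have hX := (hC.gaussian.hasGaussianLaw_eval t).memLp_two
  have hXX : ∫ ω, C t ω ^ 2 ∂P = t * (1 - t) := by
    simp_rw [sq]
    rw [hC.integral_mul, bridgeKernel, min_self]; ring
  -- This equals the second moment of the partial sum, so the error is orthogonal to the partial sum
  -- and the square collapses to a difference.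
  have hXY : ∫ ω, C t ω * ∑ k ∈ s, a k * coord C k ω ∂P = ∑ k ∈ s, a k ^ 2 * lam k := by
    simp_rw [sum_mul_coord hc]
    rw [hC.integral_mul_integral hm hc (by fun_prop), integral_bridgeKernel_mul_quotComb]
    exact Finset.sum_congr rfl fun k _ => by simp only [a]; ring
  have hYY := integral_sq_of_hasLaw_gaussian hY
  rw [Real.coe_toNNReal _
    (Finset.sum_nonneg fun k _ => mul_nonneg (sq_nonneg _) (lam_pos k).le)] at hYY
  have e : ∀ ω, (C t ω - ∑ k ∈ s, coord C k ω * (basisPoly k).eval (t : ℝ)) ^ 2 =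
      C t ω ^ 2 - 2 * (C t ω * ∑ k ∈ s, a k * coord C k ω) +
        (∑ k ∈ s, a k * coord C k ω) ^ 2 := by
    intro ω
    have : ∑ k ∈ s, coord C k ω * (basisPoly k).eval (t : ℝ) = ∑ k ∈ s, a k * coord C k ω :=
      Finset.sum_congr rfl fun k _ => mul_comm _ _
    rw [this]; ring
  simp_rw [e]
  have hi : Integrable (fun ω => 2 * (C t ω * ∑ k ∈ s, a k * coord C k ω)) P :=
    (hX.integrable_mul hYm).const_mul 2
  have hi' : Integrable (fun ω => C t ω ^ 2 - 2 * (C t ω * ∑ k ∈ s, a k * coord C k ω)) P :=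
    hX.integrable_sq.sub hi
  rw [integral_add hi' hYm.integrable_sq, integral_sub hX.integrable_sq hi, integral_const_mul, hXX,
    hXY, hYY]
  have : ∑ k ∈ s, a k ^ 2 * lam k = ∑ k ∈ s, lam k * (basisPoly k).eval (t : ℝ) ^ 2 :=
    Finset.sum_congr rfl fun k _ => mul_comm _ _
  rw [this]; ring

lemma IsBrownianBridge.tendsto_eLpNorm (hC : IsBrownianBridge C P)
    (hm : ∀ t, Measurable (C t)) (hc : ∀ ω, Continuous fun t => C t ω) (t : I) :
    Tendsto (fun n : ℕ => eLpNorm (fun ω => C t ω -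
      ∑ k ∈ Finset.range n, coord C k ω * (basisPoly k).eval (t : ℝ)) 2 P) atTop (𝓝 0) := by
  have hmem : ∀ n : ℕ, MemLp (fun ω => C t ω -
      ∑ k ∈ Finset.range n, coord C k ω * (basisPoly k).eval (t : ℝ)) 2 P := fun n =>
    (hC.gaussian.hasGaussianLaw_eval t).memLp_two.sub (memLp_finsetSum _ fun k _ =>
      (memLp_two_of_hasLaw_gaussian (hC.hasLaw_coord hm hc k)).mul_const _)
  have h0 : Tendsto (fun n : ℕ => ENNReal.ofReal (((t : ℝ) * (1 - t) -
      ∑ k ∈ Finset.range n, lam k * (basisPoly k).eval (t : ℝ) ^ 2) ^ (2 : ℝ)⁻¹)) atTop (𝓝 0) := by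
    have h1 := (hasSum_lam_mul_basisPoly_sq t).tendsto_sum_nat.const_sub ((t : ℝ) * (1 - t))
    rw [sub_self] at h1
    have h2 := ENNReal.tendsto_ofReal (h1.rpow_const (p := (2 : ℝ)⁻¹) (.inr (by norm_num)))
    simpa using h2
  refine h0.congr fun n => ?_
  rw [(hmem n).eLpNorm_eq_integral_rpow_norm (by norm_num) (by norm_num),
    ← hC.integral_sub_sum_sq hm hc]
  simp

end Bridge

/-! ### Optimality of the eigenbasis. -/

lemma lintegral_sq_Lp {α : Type*} [MeasurableSpace α] {ν : Measure α} (g : Lp ℝ 2 ν) :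
    ∫⁻ t, ENNReal.ofReal (g t ^ 2) ∂ν = ENNReal.ofReal (‖g‖ ^ 2) := by
  rw [← real_inner_self_eq_norm_sq, inner_Lp_eq_integral,
    ← ofReal_integral_eq_lintegral_ofReal (Lp.memLp g).integrable_sq
      (.of_forall fun _ => sq_nonneg _)]
  simp_rw [sq]

lemma norm_sub_sum_sq_add {H : Type*} [NormedAddCommGroup H] [InnerProductSpace ℝ H] {v : ℕ → H}
    (hv : Orthonormal ℝ v) (b : H) (s : Finset ℕ) :
    ‖b - ∑ k ∈ s, inner ℝ b (v k) • v k‖ ^ 2 + ∑ k ∈ s, inner ℝ b (v k) ^ 2 = ‖b‖ ^ 2 := by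
  have h1 : inner ℝ b (∑ k ∈ s, inner ℝ b (v k) • v k) = ∑ k ∈ s, inner ℝ b (v k) ^ 2 := by
    rw [inner_sum]
    exact Finset.sum_congr rfl fun k _ => by rw [inner_smul_right, sq]
  have h2 : ‖∑ k ∈ s, inner ℝ b (v k) • v k‖ ^ 2 = ∑ k ∈ s, inner ℝ b (v k) ^ 2 := by
    rw [← real_inner_self_eq_norm_sq, hv.inner_sum]
    exact Finset.sum_congr rfl fun k _ => by simp [sq]
  rw [norm_sub_sq_real, h1, h2]
  ring

/-- The variational inequality behind the optimality of the eigenbasis: an orthonormal family of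
size `n` captures at most the sum of the `n` largest eigenvalues. -/
lemma sum_tsum_inner_sq_mul_lam_le {H : Type*} [NormedAddCommGroup H] [InnerProductSpace ℝ H]
    (e : HilbertBasis ℕ ℝ H) {f : ℕ → H} (hf : Orthonormal ℝ f) (n : ℕ) :
    ∑ k ∈ Finset.range n, ∑' j, inner ℝ (f k) (e j) ^ 2 * lam j ≤ ∑ k ∈ Finset.range n, lam k := by
  have hone : ∀ k, HasSum (fun j => inner ℝ (f k) (e j) ^ 2) 1 := by
    intro k
    have := e.hasSum_inner_mul_inner (f k) (f k)
    rw [real_inner_self_eq_norm_sq, hf.1 k, one_pow] at this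
    simpa only [real_inner_comm (f k), ← sq] using this
  have hsum : ∀ k, Summable fun j => inner ℝ (f k) (e j) ^ 2 * lam j := by
    intro k
    refine Summable.of_nonneg_of_le (fun j => mul_nonneg (sq_nonneg _) (lam_pos j).le)
      (fun j => ?_) ((hone k).summable.mul_right (lam 0))
    exact mul_le_mul_of_nonneg_left (lam_antitone (Nat.zero_le j)) (sq_nonneg _)
  -- The share of e_j captured by the family: between 0 and 1 by Bessel, with total n.
  let γ : ℕ → ℝ := fun j => ∑ k ∈ Finset.range n, inner ℝ (f k) (e j) ^ 2
  have hγ : HasSum γ n := by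
    simpa using hasSum_sum fun k (_ : k ∈ Finset.range n) => hone k
  have hγlam : HasSum (fun j => γ j * lam j)
      (∑ k ∈ Finset.range n, ∑' j, inner ℝ (f k) (e j) ^ 2 * lam j) := by
    have := hasSum_sum fun k (_ : k ∈ Finset.range n) => (hsum k).hasSum
    simpa only [γ, Finset.sum_mul] using this
  have hγ0 : ∀ j, 0 ≤ γ j := fun j => Finset.sum_nonneg fun k _ => sq_nonneg _
  have hγ1 : ∀ j, γ j ≤ 1 := by
    intro j
    have := hf.sum_inner_products_le (e j) (s := Finset.range n)
    rw [e.orthonormal.1 j, one_pow] at this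
    simpa only [γ, Real.norm_eq_abs, sq_abs] using this
  -- After subtracting the threshold `lam n`, the terms with j < n are nonnegative and largest at γ
  -- = 1, while the rest are nonpositive.
  have h1 : HasSum (fun j => γ j * lam j - γ j * lam n)
      ((∑ k ∈ Finset.range n, ∑' j, inner ℝ (f k) (e j) ^ 2 * lam j) - n * lam n) :=
    hγlam.sub (hγ.mul_right (lam n))
  have h2 : HasSum (fun j => if j ∈ Finset.range n then lam j - lam n else 0)
      (∑ j ∈ Finset.range n, (lam j - lam n)) := by
    have := hasSum_sum_of_ne_finset_zero (L := .unconditional ℕ) (s := Finset.range n)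
      (f := fun j => if j ∈ Finset.range n then lam j - lam n else 0) fun j hj => if_neg hj
    rwa [Finset.sum_congr rfl fun j hj => if_pos hj] at this
  have h3 := hasSum_le (fun j => ?_) h1 h2
  · rw [Finset.sum_sub_distrib, Finset.sum_const, Finset.card_range, nsmul_eq_mul] at h3
    linarith
  · rw [← mul_sub]
    split_ifs with hj
    · exact mul_le_of_le_one_left (sub_nonneg.2 (lam_antitone (Finset.mem_range.1 hj).le)) (hγ1 j)
    · exact mul_nonpos_of_nonneg_of_nonpos (hγ0 j)
        (sub_nonpos.2 (lam_antitone (not_lt.1 fun h => hj (Finset.mem_range.2 h))))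

lemma coeff_bridgeBasis {Ω : Type*} (C : I → Ω → ℝ) (k : ℕ) (ω : Ω) :
    coeff C (bridgeBasis k) ω = coord C k ω := by
  rw [coord, ← integral_mul_basisPoly_bridgeMeasure]
  apply integral_congr_ae
  filter_upwards [bridgeBasis_ae_eq k] with t ht
  rw [ht]

lemma coeff_eq_inner {Ω : Type*} {C : I → Ω → ℝ} {ω : Ω}
    (h : MemLp (fun t => C t ω) 2 bridgeMeasure) (g : Lp ℝ 2 bridgeMeasure) :
    coeff C g ω = inner ℝ (h.toLp _) g := by
  rw [inner_toLp_left]; rfl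

/-- Pythagoras for the truncated expansion of one path. -/
lemma lintegral_sub_sum_add {Ω : Type*} {C : I → Ω → ℝ} {ω : Ω}
    (h : MemLp (fun t => C t ω) 2 bridgeMeasure) {f : ℕ → Lp ℝ 2 bridgeMeasure}
    (hf : Orthonormal ℝ f) (s : Finset ℕ) :
    ∫⁻ t, ENNReal.ofReal ((C t ω - ∑ k ∈ s, coeff C (f k) ω * f k t) ^ 2) ∂bridgeMeasure +
      ∑ k ∈ s, ENNReal.ofReal (coeff C (f k) ω ^ 2) =
      ∫⁻ t, ENNReal.ofReal (C t ω ^ 2) ∂bridgeMeasure := by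
  set b := h.toLp (fun t => C t ω)
  have hcf : ∀ k, coeff C (f k) ω = inner ℝ b (f k) := fun k => coeff_eq_inner h _
  have hbt : b =ᵐ[bridgeMeasure] fun t => C t ω := h.coeFn_toLp
  have e1 : ∫⁻ t, ENNReal.ofReal (C t ω ^ 2) ∂bridgeMeasure = ENNReal.ofReal (‖b‖ ^ 2) := by
    rw [← lintegral_sq_Lp]
    apply lintegral_congr_ae
    filter_upwards [hbt] with t ht
    rw [ht]
  have e2 : ∫⁻ t, ENNReal.ofReal ((C t ω - ∑ k ∈ s, coeff C (f k) ω * f k t) ^ 2) ∂bridgeMeasure =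
      ENNReal.ofReal (‖b - ∑ k ∈ s, inner ℝ b (f k) • f k‖ ^ 2) := by
    rw [← lintegral_sq_Lp]
    apply lintegral_congr_ae
    have hsm : ∀ᵐ t ∂bridgeMeasure, ∀ k, (inner ℝ b (f k) • f k : Lp ℝ 2 bridgeMeasure) t =
        inner ℝ b (f k) * f k t := by
      rw [ae_all_iff]
      intro k
      filter_upwards [Lp.coeFn_smul (inner ℝ b (f k)) (f k)] with t ht
      rw [ht]; rfl
    filter_upwards [hbt, hsm, Lp.coeFn_sub b (∑ k ∈ s, inner ℝ b (f k) • f k),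
      Lp.coeFn_finsetSum s fun k => inner ℝ b (f k) • f k] with t h1 h2 h3 h4
    rw [h3, Pi.sub_apply, h4, h1, Finset.sum_apply]
    simp_rw [h2, hcf]
  rw [e1, e2, ← norm_sub_sum_sq_add hf b s, ENNReal.ofReal_add (sq_nonneg _)
    (Finset.sum_nonneg fun _ _ => sq_nonneg _), ENNReal.ofReal_sum_of_nonneg fun _ _ => sq_nonneg _]
  simp_rw [hcf]

section Bridge

variable {Ω : Type*} [MeasurableSpace Ω] {P : Measure Ω} {C : I → Ω → ℝ}

/-- By Tonelli, the variance t(1-t) cancels the density of μ, leaving the length of [0,1]. -/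
lemma IsBrownianBridge.lintegral_lintegral_sq (hC : IsBrownianBridge C P)
    (hm : ∀ t, Measurable (C t)) (hc : ∀ ω, Continuous fun t => C t ω) :
    ∫⁻ ω, ∫⁻ t, ENNReal.ofReal (C t ω ^ 2) ∂bridgeMeasure ∂P = 1 := by
  have hP := hC.gaussian.isProbabilityMeasure
  have hu := measurable_uncurry_of_continuous_of_measurable hc hm
  rw [lintegral_lintegral_swap
    (((hu.comp measurable_swap).pow_const 2).ennreal_ofReal.aemeasurable)]
  have h : ∀ t : I, ∫⁻ ω, ENNReal.ofReal (C t ω ^ 2) ∂P = ENNReal.ofReal ((t : ℝ) * (1 - t)) := by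
    intro t
    rw [← ofReal_integral_eq_lintegral_ofReal
      (hC.gaussian.hasGaussianLaw_eval t).memLp_two.integrable_sq (.of_forall fun _ => sq_nonneg _)]
    simp_rw [sq]
    rw [hC.integral_mul, bridgeKernel, min_self]
    ring_nf
  simp_rw [h]
  rw [lintegral_bridgeMeasure (by fun_prop)]
  have h1 : ∀ᵐ t : I, ENNReal.ofReal (1 / ((t : ℝ) * (1 - t))) *
      ENNReal.ofReal ((t : ℝ) * (1 - t)) = 1 := by
    filter_upwards [ae_interior] with t ht
    have hpos : 0 < (t : ℝ) * (1 - t) := mul_pos ht.1 (by linarith [ht.2])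
    rw [← ENNReal.ofReal_mul (one_div_pos.2 hpos).le, one_div_mul_cancel hpos.ne',
      ENNReal.ofReal_one]
  rw [lintegral_congr_ae h1]
  simp

/-- Continuity alone does not give square integrability against the singular weight; finite expected
energy does, almost surely. Coefficients then become inner products in L²(μ). -/
lemma IsBrownianBridge.ae_memLp (hC : IsBrownianBridge C P)
    (hm : ∀ t, Measurable (C t)) (hc : ∀ ω, Continuous fun t => C t ω) :
    ∀ᵐ ω ∂P, MemLp (fun t => C t ω) 2 bridgeMeasure := by
  have hu := measurable_uncurry_of_continuous_of_measurable hc hm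
  have hmeas : Measurable fun ω => ∫⁻ t, ENNReal.ofReal (C t ω ^ 2) ∂bridgeMeasure :=
    Measurable.lintegral_prod_right' (f := fun p : Ω × I => ENNReal.ofReal (C p.2 p.1 ^ 2))
      ((hu.comp measurable_swap).pow_const 2).ennreal_ofReal
  have hfin := ae_lt_top hmeas (by rw [hC.lintegral_lintegral_sq hm hc]; simp)
  filter_upwards [hfin] with ω hω
  have hω' := (hc ω).measurable
  rw [memLp_two_iff_integrable_sq hω'.aestronglyMeasurable]
  refine ⟨(hω'.pow_const 2).aestronglyMeasurable, ?_⟩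
  rwa [hasFiniteIntegral_iff_ofReal (.of_forall fun _ => sq_nonneg _)]

lemma measurable_coeff (hm : ∀ t, Measurable (C t)) (hc : ∀ ω, Continuous fun t => C t ω)
    (g : Lp ℝ 2 bridgeMeasure) : Measurable (coeff C g) := by
  have hu := measurable_uncurry_of_continuous_of_measurable hc hm
  have : StronglyMeasurable (Function.uncurry fun (ω : Ω) (t : I) => C t ω * g t) :=
    ((hu.comp measurable_swap).mul ((Lp.stronglyMeasurable g).measurable.comp
      measurable_snd)).stronglyMeasurable
  exact this.integral_prod_right.measurable

lemma IsBrownianBridge.lintegral_lintegral_sub_add (hC : IsBrownianBridge C P)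
    (hm : ∀ t, Measurable (C t)) (hc : ∀ ω, Continuous fun t => C t ω)
    {f : ℕ → Lp ℝ 2 bridgeMeasure} (hf : Orthonormal ℝ f) (s : Finset ℕ) :
    ∫⁻ ω, ∫⁻ t, ENNReal.ofReal ((C t ω - ∑ k ∈ s, coeff C (f k) ω * f k t) ^ 2) ∂bridgeMeasure ∂P +
      ∑ k ∈ s, ∫⁻ ω, ENNReal.ofReal (coeff C (f k) ω ^ 2) ∂P = 1 := by
  have hmeas : ∀ k, Measurable fun ω => ENNReal.ofReal (coeff C (f k) ω ^ 2) := fun k =>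
    ((measurable_coeff hm hc (f k)).pow_const 2).ennreal_ofReal
  rw [← lintegral_finsetSum _ fun k _ => hmeas k,
    ← lintegral_add_right _ (Finset.measurable_fun_sum s fun k _ => hmeas k),
    ← hC.lintegral_lintegral_sq hm hc]
  apply lintegral_congr_ae
  filter_upwards [hC.ae_memLp hm hc] with ω hω
  exact lintegral_sub_sum_add hω hf s

/-- An upper bound suffices for optimality, so Fatou is enough: Parseval along almost every path
gives the limit, and the partial sums have known variances. -/
lemma IsBrownianBridge.lintegral_coeff_sq_le (hC : IsBrownianBridge C P)
    (hm : ∀ t, Measurable (C t)) (hc : ∀ ω, Continuous fun t => C t ω)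
    (g : Lp ℝ 2 bridgeMeasure) :
    ∫⁻ ω, ENNReal.ofReal (coeff C g ω ^ 2) ∂P ≤
      ENNReal.ofReal (∑' j, inner ℝ g (bridgeBasis j) ^ 2 * lam j) := by
  let a : ℕ → ℝ := fun j => inner ℝ g (bridgeBasis j)
  have hsum : Summable fun j => a j ^ 2 * lam j := by
    have h1 := bridgeBasis.summable_inner_mul_inner g g
    simp_rw [real_inner_comm g, ← sq] at h1
    refine Summable.of_nonneg_of_le (fun j => mul_nonneg (sq_nonneg _) (lam_pos j).le)
      (fun j => ?_) (h1.mul_right (lam 0))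
    exact mul_le_mul_of_nonneg_left (lam_antitone (Nat.zero_le j)) (sq_nonneg _)
  let S : ℕ → Ω → ℝ≥0∞ := fun N ω =>
    ENNReal.ofReal ((∑ j ∈ Finset.range N, a j * coord C j ω) ^ 2)
  have hlim : ∀ᵐ ω ∂P, Tendsto (fun N => S N ω) atTop (𝓝 (ENNReal.ofReal (coeff C g ω ^ 2))) := by
    filter_upwards [hC.ae_memLp hm hc] with ω hω
    have h1 := (bridgeBasis.hasSum_inner_mul_inner g (hω.toLp _)).tendsto_sum_nat
    simp_rw [real_inner_comm (hω.toLp _), ← coeff_eq_inner hω, coeff_bridgeBasis] at h1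
    exact ENNReal.tendsto_ofReal (h1.pow 2)
  calc ∫⁻ ω, ENNReal.ofReal (coeff C g ω ^ 2) ∂P
      = ∫⁻ ω, liminf (fun N => S N ω) atTop ∂P :=
        lintegral_congr_ae (hlim.mono fun ω h => h.liminf_eq.symm)
    _ ≤ liminf (fun N => ∫⁻ ω, S N ω ∂P) atTop := by
        refine lintegral_liminf_le fun N => ?_
        exact ((Finset.measurable_fun_sum _ fun k _ =>
          (measurable_coord hm hc k).const_mul (a k)).pow_const 2).ennreal_ofReal
    _ = ENNReal.ofReal (∑' j, a j ^ 2 * lam j) := by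
        apply Tendsto.liminf_eq
        have h2 : ∀ N, ∫⁻ ω, S N ω ∂P =
            ENNReal.ofReal (∑ j ∈ Finset.range N, a j ^ 2 * lam j) := fun N =>
          lintegral_sq_of_hasLaw_gaussian (hC.hasLaw_sum_coord hm hc _ a)
        simp_rw [h2]
        exact ENNReal.tendsto_ofReal hsum.hasSum.tendsto_sum_nat

lemma IsBrownianBridge.lintegral_coeff_bridgeBasis_sq (hC : IsBrownianBridge C P)
    (hm : ∀ t, Measurable (C t)) (hc : ∀ ω, Continuous fun t => C t ω) (k : ℕ) :
    ∫⁻ ω, ENNReal.ofReal (coeff C (bridgeBasis k) ω ^ 2) ∂P = ENNReal.ofReal (lam k) := by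
  simp_rw [coeff_bridgeBasis]
  exact lintegral_sq_of_hasLaw_gaussian (hC.hasLaw_coord hm hc k)

lemma IsBrownianBridge.lintegral_sub_bridgeBasis_le (hC : IsBrownianBridge C P)
    (hm : ∀ t, Measurable (C t)) (hc : ∀ ω, Continuous fun t => C t ω)
    {f : ℕ → Lp ℝ 2 bridgeMeasure} (hf : Orthonormal ℝ f) (n : ℕ) :
    ∫⁻ ω, ∫⁻ t, ENNReal.ofReal ((C t ω - ∑ k ∈ Finset.range n,
        coeff C (bridgeBasis k) ω * bridgeBasis k t) ^ 2) ∂bridgeMeasure ∂P ≤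
      ∫⁻ ω, ∫⁻ t, ENNReal.ofReal ((C t ω - ∑ k ∈ Finset.range n,
        coeff C (f k) ω * f k t) ^ 2) ∂bridgeMeasure ∂P := by
  have h1 := hC.lintegral_lintegral_sub_add hm hc hf (Finset.range n)
  have h2 := hC.lintegral_lintegral_sub_add hm hc bridgeBasis.orthonormal (Finset.range n)
  have h3 : ∑ k ∈ Finset.range n, ∫⁻ ω, ENNReal.ofReal (coeff C (f k) ω ^ 2) ∂P ≤
      ∑ k ∈ Finset.range n, ∫⁻ ω, ENNReal.ofReal (coeff C (bridgeBasis k) ω ^ 2) ∂P := by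
    simp_rw [hC.lintegral_coeff_bridgeBasis_sq hm hc]
    refine (Finset.sum_le_sum fun k _ => hC.lintegral_coeff_sq_le hm hc (f k)).trans ?_
    rw [← ENNReal.ofReal_sum_of_nonneg fun k _ =>
        tsum_nonneg fun j => mul_nonneg (sq_nonneg _) (lam_pos j).le,
      ← ENNReal.ofReal_sum_of_nonneg fun k _ => (lam_pos k).le]
    exact ENNReal.ofReal_le_ofReal (sum_tsum_inner_sq_mul_lam_le bridgeBasis hf n)
  have hfin : ∑ k ∈ Finset.range n,
      ∫⁻ ω, ENNReal.ofReal (coeff C (bridgeBasis k) ω ^ 2) ∂P ≠ ∞ := by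
    simp_rw [hC.lintegral_coeff_bridgeBasis_sq hm hc]
    simp
  -- Error plus captured variance is 1 for both bases; finiteness permits cancellation in `ℝ≥0∞`.
  refine (ENNReal.add_le_add_iff_right hfin).1 ?_
  rw [h2, ← h1]
  gcongr

end Bridge

/-! ### Transfer from the continuous version to the given bridge. -/

lemma weightedNorm_congr {Ω : Type*} [MeasurableSpace Ω] {P : Measure Ω} {X Y : I → Ω → ℝ}
    (h : ∀ᵐ ω ∂P, ∀ᵐ t ∂bridgeMeasure, X t ω = Y t ω) : weightedNorm P X = weightedNorm P Y := by
  unfold weightedNorm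
  congr 1
  apply lintegral_congr_ae
  filter_upwards [h] with ω hω
  apply lintegral_congr_ae
  filter_upwards [hω] with t ht
  rw [ht]

lemma ae_forall_bridgeBasis_eq :
    ∀ᵐ t ∂bridgeMeasure, ∀ k, bridgeBasis k t = (basisPoly k).eval (t : ℝ) :=
  ae_all_iff.2 bridgeBasis_ae_eq

/-- The coefficient integrals are unaffected by the endpoint values. -/
lemma polyCoeff_basisPoly {Ω : Type*} (X : I → Ω → ℝ) (k : ℕ) :
    polyCoeff X (basisPoly k) = coord X k := by
  ext ω
  apply integral_congr_ae
  filter_upwards [basisPoly_div k] with t ht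
  rw [ht]

lemma lam_toNNReal (k : ℕ) : (lam k).toNNReal = 1 / (((k : ℝ≥0) + 1) * ((k : ℝ≥0) + 2)) := by
  apply NNReal.eq
  rw [Real.coe_toNNReal _ (lam_pos k).le, lam]
  push_cast
  rfl

end BridgeKL

/-- Families indexed by `k ≥ 1` in the usual notation are indexed here by `k : ℕ` with a shift by
one: `e k` is the polynomial usually written `e_{k+1}`, of degree `k + 2`. -/
theorem theorem2p2 :
    ∃ e : ℕ → ℝ[X],
      (∀ k, (e k).natDegree = k + 2) ∧
      (∀ i j, ∫ t : I, (e i).eval (t : ℝ) * (e j).eval (t : ℝ) ∂BridgeKL.bridgeMeasure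
        = if i = j then 1 else 0) ∧
      -- the `e k` are an orthonormal basis of `L²([0,1], μ)`
      (∃ b : HilbertBasis ℕ ℝ (Lp ℝ 2 BridgeKL.bridgeMeasure),
        ∀ k, b k =ᵐ[BridgeKL.bridgeMeasure] fun t : I => (e k).eval (t : ℝ)) ∧
      ∀ (Ω : Type*) [MeasurableSpace Ω] (P : Measure Ω) [IsProbabilityMeasure P]
        (B : I → Ω → ℝ), BridgeKL.IsBrownianBridge B P →
        -- the integrals defining the coefficients converge absolutely, almost surely
        (∀ k, ∀ᵐ ω ∂P, Integrable
          (fun t : I => B t ω * ((e k).eval (t : ℝ) / ((t : ℝ) * (1 - (t : ℝ)))))) ∧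
        -- the coefficients are independent centered Gaussians with the stated variances
        iIndepFun (fun k => BridgeKL.polyCoeff B (e k)) P ∧
        (∀ k : ℕ, HasLaw (BridgeKL.polyCoeff B (e k))
          (gaussianReal 0 (1 / (((k : ℝ≥0) + 1) * ((k : ℝ≥0) + 2)))) P) ∧
        -- the expansion, with convergence in `L²(ℙ)` at every time
        (∀ t : I, Tendsto
          (fun n : ℕ => eLpNorm (fun ω => B t ω -
            ∑ k ∈ Finset.range n, BridgeKL.polyCoeff B (e k) ω * (e k).eval (t : ℝ)) 2 P)
          atTop (𝓝 0)) ∧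
        -- optimality of every truncation among all orthonormal bases of `L²([0,1], μ)`
        (∀ n : ℕ,
          BridgeKL.weightedNorm P (fun t ω => B t ω -
            ∑ k ∈ Finset.range n, BridgeKL.polyCoeff B (e k) ω * (e k).eval (t : ℝ)) < ∞ ∧
          ∀ f : HilbertBasis ℕ ℝ (Lp ℝ 2 BridgeKL.bridgeMeasure),
            BridgeKL.weightedNorm P (fun t ω => B t ω -
              ∑ k ∈ Finset.range n, BridgeKL.polyCoeff B (e k) ω * (e k).eval (t : ℝ)) ≤
            BridgeKL.weightedNorm P (fun t ω => B t ω -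
              ∑ k ∈ Finset.range n, BridgeKL.coeff B (f k) ω * f k t)) := by
  open BridgeKL in
  refine ⟨basisPoly, natDegree_basisPoly, integral_basisPoly, ⟨bridgeBasis, bridgeBasis_ae_eq⟩, ?_⟩
  intro Ω _ P _ B hB
  obtain ⟨C, hC, hm, hc, hBC⟩ := hB.exists_continuous_version
  -- One null set serves every g, since off it the two paths agree at all times.
  have hcoeff : ∀ᵐ ω ∂P, ∀ g : I → ℝ, coeff B g ω = coeff C g ω := by
    filter_upwards [hBC] with ω hω g
    simp only [coeff, hω]
  have hcoord : ∀ᵐ ω ∂P, ∀ k, polyCoeff B (basisPoly k) ω = coord C k ω := by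
    filter_upwards [hBC] with ω hω k
    simp only [polyCoeff_basisPoly, coord, hω]
  have hcoord' : ∀ k, polyCoeff B (basisPoly k) =ᵐ[P] coord C k := fun k =>
    hcoord.mono fun ω h => h k
  have hleft : ∀ n : ℕ, weightedNorm P (fun t ω => B t ω -
      ∑ k ∈ Finset.range n, polyCoeff B (basisPoly k) ω * (basisPoly k).eval (t : ℝ)) =
      weightedNorm P (fun t ω => C t ω -
        ∑ k ∈ Finset.range n, coeff C (bridgeBasis k) ω * bridgeBasis k t) := by
    intro n
    apply weightedNorm_congr
    filter_upwards [hBC, hcoord] with ω h1 h2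
    filter_upwards [ae_forall_bridgeBasis_eq] with t h3
    simp only [h1, h2, h3, coeff_bridgeBasis]
  refine ⟨fun k => ?_, ?_, fun k => ?_, fun t => ?_, fun n => ⟨?_, fun f => ?_⟩⟩
  · filter_upwards [hBC] with ω hω
    have h : Integrable fun t : I => C t ω * (quotPoly k).eval (t : ℝ) :=
      integrable_of_continuous ((hc ω).mul (by fun_prop))
    refine h.congr ?_
    filter_upwards [basisPoly_div k] with t ht
    rw [hω, ht]
  · exact (hC.iIndepFun_coord hm hc).congr fun k => (hcoord' k).symm
  · rw [← lam_toNNReal]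
    exact (hC.hasLaw_coord hm hc k).congr (hcoord' k)
  · refine (hC.tendsto_eLpNorm hm hc t).congr fun n => eLpNorm_congr_ae ?_
    filter_upwards [hBC, hcoord] with ω h1 h2
    simp only [h1, h2]
  · rw [hleft, weightedNorm]
    refine ENNReal.rpow_lt_top_of_nonneg (by norm_num) (ne_top_of_le_ne_top ENNReal.one_ne_top ?_)
    rw [← hC.lintegral_lintegral_sub_add hm hc bridgeBasis.orthonormal (Finset.range n)]
    exact le_self_add
  · have hright : weightedNorm P (fun t ω => B t ω -
        ∑ k ∈ Finset.range n, coeff B (f k) ω * f k t) =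
        weightedNorm P (fun t ω => C t ω - ∑ k ∈ Finset.range n, coeff C (f k) ω * f k t) := by
      apply weightedNorm_congr
      filter_upwards [hBC, hcoeff] with ω h1 h2
      exact .of_forall fun t => by simp only [h1, h2]
    rw [hleft, hright, weightedNorm, weightedNorm]
    exact ENNReal.rpow_le_rpow (hC.lintegral_sub_bridgeBasis_le hm hc f.orthonormal n)
      (by norm_num)
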